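/- Let $k\ge 0$, let $b_1,\dots,b_k$ be points of the continuous torus $\mathbb T=\mathbb R/\mathbb Z$, and let $\beta\in[0,\infty)$ and $T>0$. For $N\ge1$ let $\mathbb T_N=\mathbb Z/N\mathbb Z$, and for $x\in\mathbb T_N$ put $\xi^N_{x,x+1}=N^{-\beta}$ if $\{b_1,\dots,b_k\}\cap(\frac xN,\frac{x+1}N]\ne\varnothing$ and $\xi^N_{x,x+1}=1$ otherwise. Let $\mathcal L_N$ be the generator of the exclusion process on $\{0,1\}^{\mathbb T_N}$ with these conductances, $$\mathcal L_Nf(\eta)=\sum_{x\in\mathbb T_N}\xi^N_{x,x+1}\,[f(\eta^{x,x+1})-f(\eta)],$$ where $\eta^{x,x+1}$ is obtained from $\eta$ by exchanging $\eta(x)$ and $\eta(x+1)$. For each $N$ let $\mu_N$ be an arbitrary probability measure on $\{0,1\}^{\mathbb T_N}$, and let $\mathbb P^\beta_{\mu_N}$ be the law on the càdlàg path space $D(\mathbb R_+,\{0,1\}^{\mathbb T_N})$ of the Markov process $(\eta_t)_{t\ge0}$ with generator $N^2\mathcal L_N$ and initial distribution $\mu_N$. Let $\mathcal M$ be the space of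 positive measures on $\mathbb T$ of total mass at most one, with the weak topology, let $$\pi^N_t=\frac1N\sum_{x\in\mathbb T_N}\eta_t(x)\,\delta_{x/N}\in\mathcal M ,$$ and let $\mathbb Q^{\beta,N}_{\mu_N}$ be the law of $(\pi^N_t)_{0\le t\le T}$ under $\mathbb P^\beta_{\mu_N}$ on the space $D([0,T],\mathcal M)$ of càdlàg paths. Then the sequence $\{\mathbb Q^{\beta,N}_{\mu_N}:N\ge1\}$ is tight in the Skorokhod topology of $D([0,T],\mathcal M)$: for every $\varepsilon>0$ there is a compact set $K\subseteq D([0,T],\mathcal M)$ with $\mathbb Q^{\beta,N}_{\mu_N}(K^c)\le\varepsilon$ for all $N\ge1$. -/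

import Mathlib

open MeasureTheory Filter Topology Set
open scoped NNReal ENNReal Uniformity

noncomputable section

namespace SlowBonds

/-! ### Càdlàg paths -/

/-- A function is càdlàg if it is right-continuous and has left limits everywhere. -/
def IsCadlag {I E : Type*} [TopologicalSpace I] [LinearOrder I] [TopologicalSpace E]
    (x : I → E) : Prop :=
  ∀ t : I, ContinuousWithinAt x (Ici t) t ∧ ∃ l : E, Tendsto x (𝓝[<] t) (𝓝 l)

/-- The space `D(I, E)` of càdlàg paths, without a topology yet. -/
structure CadlagPath (I E : Type*) [TopologicalSpace I] [LinearOrder I] [TopologicalSpace E] where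
  toFun : I → E
  isCadlag : IsCadlag toFun

instance {I E : Type*} [TopologicalSpace I] [LinearOrder I] [TopologicalSpace E] :
    CoeFun (CadlagPath I E) (fun _ => I → E) := ⟨CadlagPath.toFun⟩

/-- The σ-algebra on `D(I, E)` generated by the evaluations `x ↦ x t`. For `E` separable and
metrizable and `I = [0, T]` this is the Borel σ-algebra of the Skorokhod topology. -/
instance CadlagPath.instMeasurableSpace {I E : Type*} [TopologicalSpace I] [LinearOrder I]
    [TopologicalSpace E] [MeasurableSpace E] : MeasurableSpace (CadlagPath I E) :=
  MeasurableSpace.comap CadlagPath.toFun MeasurableSpace.pi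

/-! ### The Skorokhod topology on `D([0, T], E)` -/

/-- Pairs of paths `(x, y)` such that, for some increasing bijection `lam` of `[0, T]` which is
uniformly `ε`-close to the identity, `x t` and `y (lam t)` are `V`-close for all `t`. -/
def skorokhodEntourage {T : ℝ} {E : Type*} [UniformSpace E] (V : Set (E × E)) (ε : ℝ) :
    Set (CadlagPath (Icc (0 : ℝ) T) E × CadlagPath (Icc (0 : ℝ) T) E) :=
  {p | ∃ lam : Icc (0 : ℝ) T ≃o Icc (0 : ℝ) T,
    ∀ t, dist (lam t) t < ε ∧ (p.1 t, p.2 (lam t)) ∈ V}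

/-- The filter generated by the sets `skorokhodEntourage V ε`. -/
def skorokhodUniformity (T : ℝ) (E : Type*) [UniformSpace E] :
    Filter (CadlagPath (Icc (0 : ℝ) T) E × CadlagPath (Icc (0 : ℝ) T) E) where
  sets := {A | ∃ V ∈ 𝓤 E, ∃ ε > 0, skorokhodEntourage V ε ⊆ A}
  univ_sets := ⟨univ, univ_mem, 1, one_pos, subset_univ _⟩
  sets_of_superset := by
    rintro A B ⟨V, hV, ε, hε, h⟩ hAB
    exact ⟨V, hV, ε, hε, h.trans hAB⟩
  inter_sets := by
    rintro A B ⟨V, hV, ε, hε, h⟩ ⟨V', hV', ε', hε', h'⟩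
    refine ⟨V ∩ V', inter_mem hV hV', min ε ε', lt_min hε hε', ?_⟩
    rintro p ⟨lam, hl⟩
    exact ⟨h ⟨lam, fun t => ⟨(hl t).1.trans_le (min_le_left _ _), (hl t).2.1⟩⟩,
      h' ⟨lam, fun t => ⟨(hl t).1.trans_le (min_le_right _ _), (hl t).2.2⟩⟩⟩

/-- The (J1) Skorokhod topology on `D([0, T], E)`. For metrizable `E` it is the topology of the
metric `inf_lam max (sup |lam t - t|) (sup d(x t, y (lam t)))`. -/
instance CadlagPath.instUniformSpace {T : ℝ} {E : Type*} [UniformSpace E] :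
    UniformSpace (CadlagPath (Icc (0 : ℝ) T) E) :=
  UniformSpace.ofCore
    { uniformity := skorokhodUniformity T E
      refl := by
        rintro A ⟨V, hV, ε, hε, h⟩
        rintro ⟨x, y⟩ hxy
        obtain rfl : x = y := by simpa using hxy
        exact h ⟨OrderIso.refl _, fun t => ⟨by simpa using hε, refl_mem_uniformity hV⟩⟩
      symm := by
        rintro A ⟨V, hV, ε, hε, h⟩
        refine ⟨Prod.swap ⁻¹' V, symm_le_uniformity hV, ε, hε, ?_⟩
        rintro ⟨x, y⟩ ⟨lam, hl⟩
        refine h ⟨lam.symm, fun t => ⟨?_, ?_⟩⟩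
        · have := (hl (lam.symm t)).1
          rw [OrderIso.apply_symm_apply] at this
          rwa [dist_comm]
        · have := (hl (lam.symm t)).2
          rw [OrderIso.apply_symm_apply] at this
          exact this
      comp := by
        rintro A ⟨V, hV, ε, hε, h⟩
        obtain ⟨W, hW, hWV⟩ := comp_mem_uniformity_sets hV
        have hmem : skorokhodEntourage W (ε / 2) ∈ skorokhodUniformity T E :=
          ⟨W, hW, ε / 2, half_pos hε, Subset.rfl⟩
        refine mem_of_superset (mem_lift' hmem) (Subset.trans ?_ h)
        rintro ⟨x, z⟩ ⟨y, ⟨lam, hl⟩, ⟨lam', hl'⟩⟩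
        refine ⟨lam.trans lam', fun t => ⟨?_, hWV ⟨y (lam t), (hl t).2, (hl' (lam t)).2⟩⟩⟩
        have h1 := (hl t).1
        have h2 := (hl' (lam t)).1
        calc dist ((lam.trans lam') t) t ≤ dist (lam' (lam t)) (lam t) + dist (lam t) t :=
              dist_triangle _ _ _
          _ < ε := by linarith }

/-! ### The space `M` of positive measures of mass at most one on the torus -/

/-- Positive measures on the torus `ℝ / ℤ` with total mass at most one. -/
def SubProb : Type := {m : FiniteMeasure UnitAddCircle // m.mass ≤ 1}

/-- The weak topology. -/
instance : TopologicalSpace SubProb :=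
  inferInstanceAs (TopologicalSpace {m : FiniteMeasure UnitAddCircle // m.mass ≤ 1})

/-- The integrals of all continuous functions against a measure. -/
def SubProb.integrals (m : SubProb) (H : C(UnitAddCircle, ℝ)) : ℝ :=
  ∫ u, H u ∂(m.1 : Measure UnitAddCircle)

theorem SubProb.isInducing_integrals : IsInducing SubProb.integrals := by
  rw [isInducing_iff_nhds]
  intro m
  have key : ∀ F : Filter SubProb,
      F ≤ 𝓝 m ↔ Tendsto SubProb.integrals F (𝓝 (SubProb.integrals m)) := by
    intro F
    have h1 : F ≤ 𝓝 m ↔ Tendsto (fun m' : SubProb => m'.1) F (𝓝 m.1) := by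
      have : IsInducing (fun m' : SubProb => m'.1) := IsInducing.subtypeVal
      rw [← tendsto_id', this.tendsto_nhds_iff]
      rfl
    rw [h1, FiniteMeasure.tendsto_iff_forall_integral_tendsto, tendsto_pi_nhds]
    constructor
    · intro h H
      exact h (BoundedContinuousFunction.mkOfCompact H)
    · intro h f
      exact h f.toContinuousMap
  refine le_antisymm ?_ ?_
  · exact (tendsto_iff_comap.1 ((key _).1 le_rfl))
  · exact (key _).2 tendsto_comap

/-- The uniform structure of the weak topology: the coarsest one for which `m ↦ ∫ H dm` is
uniformly continuous for each continuous `H`. (`SubProb` is compact and Hausdorff, so no other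
uniform structure induces the weak topology.) -/
instance : UniformSpace SubProb :=
  (UniformSpace.comap SubProb.integrals inferInstance).replaceTopology
    SubProb.isInducing_integrals.eq_induced

instance : MeasurableSpace SubProb := borel SubProb

instance : BorelSpace SubProb := ⟨rfl⟩

/-! ### The exclusion process with slow bonds -/

/-- Configurations: `η x = true` means that the site `x` of the discrete torus is occupied. -/
abbrev Config (N : ℕ+) : Type := ZMod (N : ℕ) → Bool

/-- The conductance of the bond `{x, x + 1}`: it is `N ^ (-β)` if some `b i` lies in the image
of `(x / N, (x + 1) / N]` in the torus, and `1` otherwise. -/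
def conductance {k : ℕ} (b : Fin k → UnitAddCircle) (β : ℝ) (N : ℕ+) (x : ZMod (N : ℕ)) : ℝ :=
  open scoped Classical in
  if ∃ i, b i ∈ (fun u : ℝ => (u : UnitAddCircle)) ''
      Ioc ((x.val : ℝ) / (N : ℕ)) (((x.val : ℝ) + 1) / (N : ℕ))
  then ((N : ℕ) : ℝ) ^ (-β) else 1

/-- The configuration `η^{x,x+1}`, where the values at `x` and `x + 1` are exchanged. -/
def exchange {N : ℕ+} (η : Config N) (x : ZMod (N : ℕ)) : Config N :=
  fun y => η (Equiv.swap x (x + 1) y)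

/-- The generator `(L_N f)(η) = ∑ x, ξ_{x,x+1} (f(η^{x,x+1}) - f(η))`. -/
def generator {k : ℕ} (b : Fin k → UnitAddCircle) (β : ℝ) (N : ℕ+) :
    (Config N → ℝ) →L[ℝ] (Config N → ℝ) where
  toFun f η := ∑ x : ZMod (N : ℕ), conductance b β N x * (f (exchange η x) - f η)
  map_add' f g := by
    ext η
    simp only [Pi.add_apply, ← Finset.sum_add_distrib]
    exact Finset.sum_congr rfl fun x _ => by ring
  map_smul' c f := by
    ext η
    simp only [Pi.smul_apply, smul_eq_mul, RingHom.id_apply, Finset.mul_sum]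
    exact Finset.sum_congr rfl fun x _ => by ring
  cont := by fun_prop

/-- The transition probabilities of the Markov process with generator `N² L_N`: with the
semigroup `S_t = exp (t N² L_N)`, this is `p_t(η, ζ) = (S_t 1_{ζ})(η)`. -/
def transitionProb {k : ℕ} (b : Fin k → UnitAddCircle) (β : ℝ) (N : ℕ+) (t : ℝ)
    (η ζ : Config N) : ℝ :=
  NormedSpace.exp ((t * ((N : ℕ) : ℝ) ^ 2) • generator b β N) (Pi.single ζ 1) η

/-- `P` is the law on `D(ℝ₊, {0,1}^{T_N})` of the Markov process with initial distribution `μ` and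
generator `N² L_N`: its finite-dimensional distributions are
`P(η_{t_0} = σ_0, …, η_{t_n} = σ_n) = μ(σ_0) ∏_i p_{t_{i+1} - t_i}(σ_i, σ_{i+1})`
for `0 = t_0 ≤ t_1 ≤ … ≤ t_n`. -/
def IsExclusionLaw {k : ℕ} (b : Fin k → UnitAddCircle) (β : ℝ) (N : ℕ+)
    (μ : Measure (Config N)) (P : Measure (CadlagPath ℝ≥0 (Config N))) : Prop :=
  ∀ (n : ℕ) (t : Fin (n + 1) → ℝ≥0) (σ : Fin (n + 1) → Config N), Monotone t → t 0 = 0 →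
    P {ω | ∀ i, ω (t i) = σ i} = μ {σ 0} * ∏ i : Fin n,
      ENNReal.ofReal (transitionProb b β N (t i.succ - t i.castSucc) (σ i.castSucc) (σ i.succ))

/-! ### The empirical measure process -/

/-- The measure `N⁻¹ ∑ x, η x δ_{x/N}`. -/
def empiricalMeasureAux {N : ℕ+} (η : Config N) : Measure UnitAddCircle :=
  ((N : ℕ) : ℝ≥0∞)⁻¹ • ∑ x : ZMod (N : ℕ),
    (if η x then 1 else 0 : ℝ≥0∞) • Measure.dirac (((x.val : ℝ) / (N : ℕ) : ℝ) : UnitAddCircle)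

theorem empiricalMeasureAux_univ_le {N : ℕ+} (η : Config N) :
    empiricalMeasureAux η univ ≤ 1 := by
  have h : (∑ x : ZMod (N : ℕ), (if η x then 1 else 0 : ℝ≥0∞)) ≤ ((N : ℕ) : ℝ≥0∞) := by
    calc (∑ x : ZMod (N : ℕ), (if η x then 1 else 0 : ℝ≥0∞))
        ≤ ∑ x : ZMod (N : ℕ), (1 : ℝ≥0∞) :=
          Finset.sum_le_sum fun x _ => by split_ifs <;> simp
      _ = ((N : ℕ) : ℝ≥0∞) := by simp [ZMod.card]
  simp only [empiricalMeasureAux, Measure.smul_apply, Measure.finsetSum_apply,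
    Measure.dirac_apply_of_mem (mem_univ _), smul_eq_mul, mul_one]
  rw [mul_comm, ← div_eq_mul_inv]
  exact ENNReal.div_le_of_le_mul (by simpa using h)

/-- The empirical measure of a configuration, as an element of `M`. -/
def empiricalMeasure {N : ℕ+} (η : Config N) : SubProb :=
  ⟨⟨empiricalMeasureAux η, ⟨(empiricalMeasureAux_univ_le η).trans_lt ENNReal.one_lt_top⟩⟩,
    ENNReal.toNNReal_mono ENNReal.one_ne_top (empiricalMeasureAux_univ_le η)⟩

/-- The path `t ↦ π_t`, `0 ≤ t ≤ T`, of empirical measures of a path of configurations. -/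
def empiricalPath (T : ℝ) {N : ℕ+} (ω : CadlagPath ℝ≥0 (Config N)) :
    CadlagPath (Icc (0 : ℝ) T) SubProb where
  toFun t := empiricalMeasure (ω ⟨t, t.2.1⟩)
  isCadlag t := by
    have hc : Continuous (empiricalMeasure (N := N)) := continuous_of_discreteTopology
    have hj : Continuous (fun s : Icc (0 : ℝ) T => (⟨s, s.2.1⟩ : ℝ≥0)) := by fun_prop
    obtain ⟨h1, l, h2⟩ := ω.isCadlag ⟨t, t.2.1⟩
    refine ⟨?_, empiricalMeasure l, ?_⟩
    · refine hc.continuousAt.comp_continuousWithinAt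
        (ContinuousWithinAt.comp (t := Ici (⟨t, t.2.1⟩ : ℝ≥0)) h1 hj.continuousWithinAt ?_)
      intro s hs
      exact hs
    · refine (hc.tendsto l).comp (h2.comp ?_)
      refine tendsto_nhdsWithin_iff.2 ⟨hj.continuousAt.tendsto.mono_left nhdsWithin_le_nhds, ?_⟩
      filter_upwards [self_mem_nhdsWithin] with s hs
      exact hs

/-- So the law of the process below is a genuine image measure. -/
theorem measurable_empiricalPath (T : ℝ) {N : ℕ+} :
    Measurable (empiricalPath T (N := N)) := by
  refine measurable_comap_iff.2 (measurable_pi_iff.2 fun t => ?_)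
  have h1 : Measurable (empiricalMeasure (N := N)) := Measurable.of_discrete
  have h2 : Measurable (fun ω : CadlagPath ℝ≥0 (Config N) => ω ⟨t, t.2.1⟩) :=
    (measurable_pi_apply _).comp (comap_measurable _)
  exact h1.comp h2

/-- The law on `D([0, T], M)` of the empirical process, if `P` is the law of the configurations. -/
def empiricalLaw (T : ℝ) {N : ℕ+} (P : Measure (CadlagPath ℝ≥0 (Config N))) :
    Measure (CadlagPath (Icc (0 : ℝ) T) SubProb) :=
  P.map (empiricalPath T)

end SlowBonds

end

open SlowBonds

noncomputable section

namespace SlowBonds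

/-! ### Compactness from a modulus of continuity -/

section Modulus

variable {T : ℝ} {E : Type*} [UniformSpace E]

/-! For a smooth test function `H`, put `F = ∫ H dπ^N`. Exchanging `x` and `x + 1` changes `F` by
`O(N⁻²)`. Writing a conductance as `1 - (1 - ξ)`, the part with unit rates has drift `O(1)` after
summation by parts, because second differences of `H` are `O(N⁻²)`. The at most `k` slow bonds
contribute a first difference `O(N⁻¹)` each, so again `O(1)`, whatever the size of `N^{-β} ≤ 1`.
Hence `N² L_N e^{θF} ≤ B e^{θF}` with `B = θ(k+1)C + θ²C²/N` (`generator_exp_le`). The exponential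
supermartingale and a maximal inequality then bound the probability that `F` rises by `ε` within
time `r` by `exp(Br - θε)` (`IsExclusionLaw.measure_exists_le`). Taking the time step small, then
`θ` large, then `N` large gives a modulus of continuity for `F` with probability close to one, for
all `N ≥ N₀` (`exists_measure_compl_modulusSetOn_le`).

It suffices to control countably many pairs (test function, precision), since real parts of
trigonometric polynomials are dense and `SubProb` is compact. The threshold `N₀` depends on the
pair, so for fixed `N` only some of the moduli are available. Each single law is therefore also
confined to a compact set `K N`: the empirical measure takes finitely many values, and most paths
are step functions with well separated jumps (`IsSeparatedOn.mem_stepPaths`, `isCompact_stepPaths`).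
`isCompact_modulusSet_union` glues these compact sets and the moduli into one compact set.

All events are expressed through a countable right-dense set of times, because the σ-algebra on
paths is the one generated by evaluations. -/

theorem mem_uniformity_cadlagPath
    {A : Set (CadlagPath (Icc (0 : ℝ) T) E × CadlagPath (Icc (0 : ℝ) T) E)} :
    A ∈ 𝓤 (CadlagPath (Icc (0 : ℝ) T) E) ↔
      ∃ V ∈ 𝓤 E, ∃ ε > 0, skorokhodEntourage V ε ⊆ A := Iff.rfl

/-- Paths whose values at times less than `δ` apart are `V`-close. -/
def modulusSet (T : ℝ) (V : Set (E × E)) (δ : ℝ) : Set (CadlagPath (Icc (0 : ℝ) T) E) :=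
  {x | ∀ u v, dist u v < δ → (x u, x v) ∈ V}

/-- The inequality `dist u v < δ` is strict: a time change that moves points by less than half the
slack keeps the images of `u` and `v` less than `δ` apart, so the modulus of a nearby path applies
to them. -/
theorem isClosed_modulusSet {V : Set (E × E)} (hV : IsClosed V) (δ : ℝ) :
    IsClosed (modulusSet T V δ) := by
  refine isClosed_of_closure_subset fun x hx u v huv => ?_
  rw [← hV.closure_eq, mem_closure_iff_nhds]
  intro O hO
  rw [nhds_prod_eq, mem_prod_iff] at hO
  obtain ⟨O₁, h₁, O₂, h₂, hO⟩ := hO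
  obtain ⟨W₁, hW₁, h₁⟩ := UniformSpace.mem_nhds_iff.1 h₁
  obtain ⟨W₂, hW₂, h₂⟩ := UniformSpace.mem_nhds_iff.1 h₂
  have hε : 0 < (δ - dist u v) / 2 := by linarith
  obtain ⟨y, ⟨lam, hl⟩, hy⟩ := (mem_closure_iff_nhds.1 hx) _ (UniformSpace.mem_nhds_iff.2
    ⟨_, mem_uniformity_cadlagPath.2 ⟨_, inter_mem hW₁ hW₂, _, hε, Subset.rfl⟩, Subset.rfl⟩)
  refine ⟨(y (lam u), y (lam v)), hO ⟨h₁ (hl u).2.1, h₂ (hl v).2.2⟩, hy _ _ ?_⟩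
  have h3 := (hl u).1
  have h4 := (hl v).1
  have h5 := dist_triangle4 (lam u) u v (lam v)
  rw [dist_comm v] at h5
  linarith

theorem eventually_modulus {ι : Type*} {V : ι → Set (E × E)} {δ : ι → ℝ} (hδ : ∀ p, 0 < δ p)
    (hV : ⨅ p, 𝓟 (V p) ≤ 𝓤 E) {F : Filter (CadlagPath (Icc (0 : ℝ) T) E)}
    (hF : ∀ p, modulusSet T (V p) (δ p) ∈ F) {U : Set (E × E)} (hU : U ∈ 𝓤 E) :
    ∃ r > 0, modulusSet T U r ∈ F := by
  refine iInf_sets_induct (hV hU) (p := fun U => ∃ r > 0, modulusSet T U r ∈ F)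
    ⟨1, one_pos, mem_of_superset univ_mem fun x _ u v _ => mem_univ _⟩ ?_
  rintro p s₁ s₂ hs₁ ⟨r, hr, hs₂⟩
  refine ⟨min (δ p) r, lt_min (hδ p) hr, ?_⟩
  filter_upwards [hF p, hs₂] with x h1 h2 u v huv
  exact ⟨hs₁ (h1 u v (huv.trans_le (min_le_left _ _))), h2 u v (huv.trans_le (min_le_right _ _))⟩

/-- Arzelà–Ascoli by ultrafilters. Pointwise limits exist because `E` is compact, they inherit the
closed moduli and so form a continuous path, and a finite `r`-net of times makes the convergence
uniform. Uniform convergence is Skorokhod convergence with the identity time change. -/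
theorem exists_le_nhds_of_modulus [CompactSpace E] {ι : Type*} {V : ι → Set (E × E)} {δ : ι → ℝ}
    (hδ : ∀ p, 0 < δ p) (hVc : ∀ p, IsClosed (V p)) (hV : ⨅ p, 𝓟 (V p) ≤ 𝓤 E)
    (F : Ultrafilter (CadlagPath (Icc (0 : ℝ) T) E))
    (hF : ∀ p, modulusSet T (V p) (δ p) ∈ F) :
    ∃ y, (∀ p, y ∈ modulusSet T (V p) (δ p)) ∧ (F : Filter _) ≤ 𝓝 y := by
  have hlim : ∀ t, ∃ e : E, Tendsto (fun x : CadlagPath (Icc (0 : ℝ) T) E => x t) F (𝓝 e) := by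
    intro t
    obtain ⟨e, -, he⟩ := isCompact_univ.ultrafilter_le_nhds
      (F.map fun x : CadlagPath (Icc (0 : ℝ) T) E => x t) (by simp)
    exact ⟨e, he⟩
  choose y hy using hlim
  have hclosed : ∀ (W : Set (E × E)) (r : ℝ), IsClosed W → modulusSet T W r ∈ (F : Filter _) →
      ∀ u v, dist u v < r → (y u, y v) ∈ W := by
    intro W r hW hWF u v huv
    refine hW.mem_of_tendsto ((hy u).prodMk_nhds (hy v)) ?_
    filter_upwards [hWF] with x hx
    exact hx u v huv
  have hcont : Continuous y := by
    refine continuous_iff_continuousAt.2 fun t => Uniform.tendsto_nhds_right.2 fun U hU => ?_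
    obtain ⟨W, hW, hWc, hWU⟩ := mem_uniformity_isClosed hU
    obtain ⟨r, hr, hrF⟩ := eventually_modulus hδ hV hF hW
    refine mem_map.2 (mem_of_superset (Metric.ball_mem_nhds t hr) fun s hs => ?_)
    exact hWU (hclosed W r hWc hrF _ _ (by rwa [dist_comm]))
  let Y : CadlagPath (Icc (0 : ℝ) T) E := ⟨y, fun t =>
    ⟨hcont.continuousWithinAt, y t, hcont.continuousAt.tendsto.mono_left nhdsWithin_le_nhds⟩⟩
  refine ⟨Y, fun p => hclosed _ _ (hVc p) (hF p), ?_⟩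
  intro A hA
  obtain ⟨B, hB, hBA⟩ := UniformSpace.mem_nhds_iff.1 hA
  obtain ⟨U, hU, ε, hε, hUB⟩ := mem_uniformity_cadlagPath.1 hB
  suffices h : ∀ᶠ x in (F : Filter (CadlagPath (Icc (0 : ℝ) T) E)), ∀ t, (y t, x t) ∈ U by
    filter_upwards [h] with x hx
    exact hBA (hUB ⟨OrderIso.refl _, fun t => ⟨by simpa using hε, hx t⟩⟩)
  obtain ⟨W, hW, hWs, hWU⟩ := comp_symm_of_uniformity hU
  obtain ⟨W', hW', hWs', hWW'⟩ := comp_symm_of_uniformity hW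
  obtain ⟨W'', hW'', hWc, hWW''⟩ := mem_uniformity_isClosed hW'
  obtain ⟨r, hr, hrF⟩ := eventually_modulus hδ hV hF hW''
  obtain ⟨s, hsf, hs⟩ := Metric.totallyBounded_iff.1
    (isCompact_univ (X := Icc (0 : ℝ) T)).totallyBounded r hr
  have h1 : ∀ᶠ x in (F : Filter (CadlagPath (Icc (0 : ℝ) T) E)), ∀ t ∈ s, (y t, x t) ∈ W' :=
    (eventually_all_finite hsf).2 fun t _ => Uniform.tendsto_nhds_right.1 (hy t) hW'
  filter_upwards [h1, hrF] with x hx1 hx2 t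
  obtain ⟨t', ht', htt'⟩ := mem_iUnion₂.1 (hs (mem_univ t))
  exact hWU ⟨x t', hWW' ⟨y t', hWW'' (hclosed _ _ hWc hrF t t' htt'), hx1 _ ht'⟩,
    hWW' ⟨x t', refl_mem_uniformity hW', hWW'' (hx2 t' t (by rwa [dist_comm]))⟩⟩

/-- An ultrafilter on the union either contains one of the compact pieces, or avoids every one of
them. In the second case, for each `p` the finitely many pieces with `n < N₀ p` may be discarded,
and all that remains satisfies condition `p`; so every modulus holds along the ultrafilter. -/
theorem isCompact_modulusSet_union [CompactSpace E] {ι : Type*} {V : ι → Set (E × E)} {δ : ι → ℝ}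
    (hδ : ∀ p, 0 < δ p) (hVc : ∀ p, IsClosed (V p)) (hV : ⨅ p, 𝓟 (V p) ≤ 𝓤 E)
    (N₀ : ι → ℕ+) {K : ℕ+ → Set (CadlagPath (Icc (0 : ℝ) T) E)} (hK : ∀ n, IsCompact (K n)) :
    IsCompact ({x | ∀ p, x ∈ modulusSet T (V p) (δ p)} ∪
      ⋃ n, K n ∩ {x | ∀ p, N₀ p ≤ n → x ∈ modulusSet T (V p) (δ p)}) := by
  have hL : ∀ n, IsCompact (K n ∩ {x | ∀ p, N₀ p ≤ n → x ∈ modulusSet T (V p) (δ p)}) := by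
    intro n
    refine (hK n).inter_right ?_
    simp only [ofPred_forall]
    exact isClosed_iInter fun p => isClosed_iInter fun _ => isClosed_modulusSet (hVc p) _
  refine isCompact_iff_ultrafilter_le_nhds.2 fun F hF => ?_
  rw [le_principal_iff] at hF
  by_cases h : ∃ n, K n ∩ {x | ∀ p, N₀ p ≤ n → x ∈ modulusSet T (V p) (δ p)} ∈ F
  · obtain ⟨n, hn⟩ := h
    obtain ⟨y, hy, hFy⟩ := (hL n).ultrafilter_le_nhds F (le_principal_iff.2 hn)
    exact ⟨y, Or.inr (mem_iUnion.2 ⟨n, hy⟩), hFy⟩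
  · push Not at h
    obtain ⟨y, hy, hFy⟩ := exists_le_nhds_of_modulus hδ hVc hV F fun p => by
      have h1 : ∀ᶠ x in (F : Filter (CadlagPath (Icc (0 : ℝ) T) E)), ∀ n ∈ Iio (N₀ p),
          x ∉ K n ∩ {x | ∀ p, N₀ p ≤ n → x ∈ modulusSet T (V p) (δ p)} :=
        (eventually_all_finite (finite_Iio _)).2 fun n _ =>
          Ultrafilter.compl_mem_iff_notMem.2 (h n)
      filter_upwards [h1, hF] with x hx1 hx2
      rcases hx2 with hx2 | hx2
      · exact hx2 p
      · obtain ⟨n, hn⟩ := mem_iUnion.1 hx2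
        exact hn.2 p (not_lt.1 fun hlt => hx1 n hlt hn)
    exact ⟨y, Or.inl hy, hFy⟩

end Modulus

/-! ### Step paths -/

section StepPath

variable {T : ℝ} {E : Type*}

theorem CadlagPath.ext {I : Type*} [TopologicalSpace I] [LinearOrder I] [TopologicalSpace E]
    {x y : CadlagPath I E} (h : x.toFun = y.toFun) : x = y := by
  cases x
  cases y
  congr

/-- The jumps up to time `s`. -/
def jumpsBefore {n : ℕ} (t : Fin n → Icc (0 : ℝ) T) (s : Icc (0 : ℝ) T) : Finset (Fin n) :=
  {i | t i ≤ s}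

/-- The path whose value at time `s` is determined by the set of jump times `t i ≤ s`. -/
def stepPath [TopologicalSpace E] {n : ℕ} (t : Fin n → Icc (0 : ℝ) T) (σ : Finset (Fin n) → E) :
    CadlagPath (Icc (0 : ℝ) T) E where
  toFun s := σ (jumpsBefore t s)
  isCadlag s := by
    refine ⟨?_, σ {i | t i < s}, ?_⟩
    · refine (tendsto_congr' ?_).2 (tendsto_const_nhds (x := σ (jumpsBefore t s)))
      have h : ∀ᶠ r in 𝓝[Ici s] s, ∀ i, (t i ≤ r ↔ t i ≤ s) := by
        refine eventually_all.2 fun i => ?_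
        rcases le_or_gt (t i) s with hi | hi
        · filter_upwards [self_mem_nhdsWithin] with r hr
          exact iff_of_true (hi.trans hr) hi
        · filter_upwards [mem_nhdsWithin_of_mem_nhds (Iio_mem_nhds hi)] with r hr
          exact iff_of_false (not_le.2 hr) (not_le.2 hi)
      filter_upwards [h] with r hr
      simp only [jumpsBefore, hr]
    · refine (tendsto_congr' ?_).2 (tendsto_const_nhds (x := σ {i | t i < s}))
      have h : ∀ᶠ r in 𝓝[<] s, ∀ i, (t i ≤ r ↔ t i < s) := by
        refine eventually_all.2 fun i => ?_
        rcases lt_or_ge (t i) s with hi | hi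
        · filter_upwards [mem_nhdsWithin_of_mem_nhds (Ioi_mem_nhds hi)] with r hr
          exact iff_of_true (le_of_lt hr) hi
        · filter_upwards [self_mem_nhdsWithin] with r hr
          exact iff_of_false (not_le.2 (lt_of_lt_of_le hr hi)) (not_lt.2 hi)
      filter_upwards [h] with r hr
      simp only [jumpsBefore, hr]

/-- Jump times which are `δ`-separated from each other and from `0`, and also from `T`
unless they are equal to `T`. -/
def separatedTimes (T δ : ℝ) (n : ℕ) : Set (Fin n → Icc (0 : ℝ) T) :=
  {t | (∀ i j, i ≠ j → δ ≤ |(t i : ℝ) - t j|) ∧ ∀ i, δ ≤ t i ∧ ((t i : ℝ) ≤ T - δ ∨ (t i : ℝ) = T)}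

theorem isCompact_separatedTimes (T δ : ℝ) (n : ℕ) : IsCompact (separatedTimes T δ n) := by
  refine IsClosed.isCompact ?_
  simp only [separatedTimes, ofPred_and, ofPred_or, ofPred_forall]
  refine (isClosed_iInter fun i => isClosed_iInter fun j => isClosed_iInter fun _ =>
    isClosed_le ?_ ?_).inter (isClosed_iInter fun i =>
      (isClosed_le ?_ ?_).inter ((isClosed_le ?_ ?_).union (isClosed_eq ?_ ?_))) <;> fun_prop

/-- This Lipschitz bound keeps the time change of `exists_timeChange`, the identity plus small
multiples of tents, strictly increasing. -/
theorem abs_tent_sub_le {δ : ℝ} (hδ : 0 < δ) (a r s : ℝ) :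
    |max 0 (1 - |r - a| / δ) - max 0 (1 - |s - a| / δ)| ≤ |r - s| / δ := by
  refine (abs_max_sub_max_le_max _ _ _ _).trans ?_
  rw [sub_self, abs_zero, max_eq_right (abs_nonneg _)]
  have : 1 - |r - a| / δ - (1 - |s - a| / δ) = (|s - a| - |r - a|) / δ := by ring
  rw [this, abs_div, abs_of_pos hδ]
  refine div_le_div_of_nonneg_right ?_ hδ.le
  refine (abs_abs_sub_abs_le (s - a) (r - a)).trans ?_
  rw [abs_sub_comm r s]
  simp

/-- A small change of separated jump times is realized by a small change of time. -/
theorem exists_timeChange (hT : 0 ≤ T) {δ : ℝ} (hδ : 0 < δ) {n : ℕ} {t t' : Fin n → Icc (0 : ℝ) T}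
    (ht : t ∈ separatedTimes T δ n) (ht' : t' ∈ separatedTimes T δ n)
    (hclose : ∑ i, |(t' i : ℝ) - t i| < δ) :
    ∃ lam : Icc (0 : ℝ) T ≃o Icc (0 : ℝ) T, (∀ i, lam (t i) = t' i) ∧
      ∀ s, dist (lam s) s ≤ ∑ i, |(t' i : ℝ) - t i| := by
  -- Each jump time is moved by a tent of height one supported within distance `δ` of it. By
  -- separation the tent vanishes at the other jump times and at `0`, and the total slope of the
  -- perturbation is below one by `hclose`.
  let w : Fin n → ℝ → ℝ := fun i s => max 0 (1 - |s - t i| / δ)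
  let f : ℝ → ℝ := fun s => s + ∑ i, ((t' i : ℝ) - t i) * w i s
  have hw0 : ∀ i (s : ℝ), δ ≤ |s - t i| → w i s = 0 := fun i s h => by
    refine max_eq_left ?_
    rw [sub_nonpos, one_le_div hδ]
    exact h
  have hw1 : ∀ i s, |w i s| ≤ 1 := fun i s => by
    rw [abs_of_nonneg (le_max_left _ _)]
    exact max_le zero_le_one (sub_le_self _ (by positivity))
  have hfc : Continuous f := by fun_prop
  have hfm : StrictMono f := by
    intro r s hrs
    have h1 : |∑ i, ((t' i : ℝ) - t i) * w i s - ∑ i, ((t' i : ℝ) - t i) * w i r| ≤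
        (∑ i, |(t' i : ℝ) - t i|) * (|s - r| / δ) := by
      rw [← Finset.sum_sub_distrib, Finset.sum_mul]
      refine (Finset.abs_sum_le_sum_abs _ _).trans (Finset.sum_le_sum fun i _ => ?_)
      rw [← mul_sub, abs_mul]
      exact mul_le_mul_of_nonneg_left (abs_tent_sub_le hδ _ _ _) (abs_nonneg _)
    have h2 : (∑ i, |(t' i : ℝ) - t i|) * (|s - r| / δ) < s - r := by
      rw [abs_of_pos (sub_pos.2 hrs), mul_div_assoc', div_lt_iff₀ hδ, mul_comm (s - r)]
      exact mul_lt_mul_of_pos_right hclose (sub_pos.2 hrs)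
    have h3 := (abs_le.1 h1).1
    simp only [f]
    linarith
  have hf0 : f 0 = 0 := by
    simp only [f, zero_add]
    refine Finset.sum_eq_zero fun i _ => ?_
    rw [hw0 i 0, mul_zero]
    rw [zero_sub, abs_neg]
    exact (ht.2 i).1.trans (le_abs_self _)
  have hfT : f T = T := by
    simp only [f, add_eq_left]
    refine Finset.sum_eq_zero fun i _ => ?_
    rcases (ht.2 i).2 with h | h
    · rw [hw0 i T, mul_zero]
      exact le_trans (by linarith) (le_abs_self _)
    -- A jump at `T` must stay at `T`: the only alternative is a displacement of at least `δ`.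
    · rcases (ht'.2 i).2 with h' | h'
      · exfalso
        have h1 := Finset.single_le_sum (f := fun i => |(t' i : ℝ) - t i|)
          (fun i _ => abs_nonneg _) (Finset.mem_univ i)
        have h2 := neg_abs_le ((t' i : ℝ) - t i)
        linarith
      · rw [h, h', sub_self, zero_mul]
  have hft : ∀ i, f (t i) = t' i := by
    intro i
    change (t i : ℝ) + ∑ j, ((t' j : ℝ) - t j) * w j (t i) = t' i
    rw [Finset.sum_eq_single i]
    · simp [w]
    · intro j _ hj
      rw [hw0 j _ (ht.1 i j hj.symm), mul_zero]
    · simp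
  let g : Icc (0 : ℝ) T → Icc (0 : ℝ) T := fun s =>
    ⟨f s, hf0.symm.le.trans (hfm.monotone s.2.1), (hfm.monotone s.2.2).trans hfT.le⟩
  have hgm : StrictMono g := fun r s hrs => hfm hrs
  have hgs : Function.Surjective g := by
    intro s
    obtain ⟨r, hr, hrs⟩ := intermediate_value_Icc hT hfc.continuousOn
      (show (s : ℝ) ∈ Icc (f 0) (f T) by rw [hf0, hfT]; exact s.2)
    exact ⟨⟨r, hr⟩, Subtype.ext hrs⟩
  refine ⟨hgm.orderIsoOfSurjective g hgs, fun i => Subtype.ext (hft i), fun s => ?_⟩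
  change |f s - s| ≤ _
  simp only [f, add_sub_cancel_left]
  refine (Finset.abs_sum_le_sum_abs _ _).trans (Finset.sum_le_sum fun i _ => ?_)
  rw [abs_mul]
  exact mul_le_of_le_one_right (abs_nonneg _) (hw1 _ _)

/-- After the time change that carries one set of jump times to the other, the two paths agree
exactly, so only the size of the time change matters. -/
theorem continuousOn_stepPath [UniformSpace E] (hT : 0 ≤ T) {δ : ℝ} (hδ : 0 < δ) {n : ℕ}
    (σ : Finset (Fin n) → E) :
    ContinuousOn (fun t : Fin n → Icc (0 : ℝ) T => stepPath t σ) (separatedTimes T δ n) := by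
  intro t ht
  refine Uniform.tendsto_nhds_right.2 fun A hA => ?_
  obtain ⟨V, hV, ε, hε, hA⟩ := mem_uniformity_cadlagPath.1 hA
  have hc : Continuous fun t' : Fin n → Icc (0 : ℝ) T => ∑ i, |(t' i : ℝ) - t i| := by fun_prop
  have h1 : ∀ᶠ t' in 𝓝 t, ∑ i, |(t' i : ℝ) - t i| < min ε δ :=
    hc.continuousAt.eventually_lt continuousAt_const (by simp [hε, hδ])
  refine mem_map.2 ?_
  filter_upwards [self_mem_nhdsWithin, mem_nhdsWithin_of_mem_nhds h1] with t' ht' hclose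
  obtain ⟨lam, hl, hd⟩ := exists_timeChange hT hδ ht ht' (hclose.trans_le (min_le_right _ _))
  refine hA ⟨lam, fun s => ⟨(hd s).trans_lt (hclose.trans_le (min_le_left _ _)), ?_⟩⟩
  have : (stepPath t σ) s = (stepPath t' σ) (lam s) := by
    simp only [stepPath, jumpsBefore, ← hl, lam.le_iff_le]
  rw [this]
  exact refl_mem_uniformity hV

/-- The step paths with at most `m` jumps, `δ`-separated, and values in `S`. -/
def stepPaths (T : ℝ) [TopologicalSpace E] (S : Set E) (δ : ℝ) (m : ℕ) :
    Set (CadlagPath (Icc (0 : ℝ) T) E) :=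
  ⋃ n ∈ Iic m, ⋃ σ ∈ {σ : Finset (Fin n) → E | ∀ A, σ A ∈ S},
    (fun t => stepPath t σ) '' separatedTimes T δ n

/-- As `S` is finite there are finitely many `σ`, so this is a finite union of continuous images of
compact sets of jump times. -/
theorem isCompact_stepPaths [UniformSpace E] (hT : 0 ≤ T) {S : Set E} (hS : S.Finite) {δ : ℝ}
    (hδ : 0 < δ) (m : ℕ) : IsCompact (stepPaths T S δ m) := by
  refine (finite_Iic m).isCompact_biUnion fun n _ => ?_
  refine (Set.Finite.pi' fun _ => hS).isCompact_biUnion fun σ _ => ?_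
  exact (isCompact_separatedTimes T δ n).image_of_continuousOn (continuousOn_stepPath hT hδ σ)

end StepPath

/-! ### Paths with finitely many values -/

section FiniteValued

variable {T : ℝ} {E : Type*} [TopologicalSpace E] [T1Space E] {S : Set E}
  {x : CadlagPath (Icc (0 : ℝ) T) E}

theorem eventually_eq_of_tendsto_finite {α : Type*} {F : Filter α} {f : α → E} {l : E}
    (hS : S.Finite) (hf : ∀ᶠ a in F, f a ∈ S) (h : Tendsto f F (𝓝 l)) : ∀ᶠ a in F, f a = l := by
  have h1 : (S \ {l})ᶜ ∈ 𝓝 l := (hS.subset sdiff_subset).isClosed.isOpen_compl.mem_nhds (by simp)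
  filter_upwards [h h1, hf] with a ha1 ha2
  by_contra hne
  exact ha1 ⟨ha2, hne⟩

theorem eventually_eq_right (hS : S.Finite) (hx : ∀ t, x t ∈ S) (t : Icc (0 : ℝ) T) :
    ∀ᶠ s in 𝓝[≥] t, x s = x t :=
  eventually_eq_of_tendsto_finite hS (Eventually.of_forall hx) (x.isCadlag t).1

theorem eventually_eq_left (hS : S.Finite) (hx : ∀ t, x t ∈ S) (t : Icc (0 : ℝ) T) :
    ∃ l, ∀ᶠ s in 𝓝[<] t, x s = l := by
  obtain ⟨l, hl⟩ := (x.isCadlag t).2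
  exact ⟨l, eventually_eq_of_tendsto_finite hS (Eventually.of_forall hx) hl⟩

/-- The path does not jump twice within time `δ`, and not at all within time `δ` of `0` and `T`
(with the possible exception of `T` itself); only times in `D` are taken into account. -/
structure IsSeparatedOn (x : CadlagPath (Icc (0 : ℝ) T) E) (D : Set (Icc (0 : ℝ) T)) (δ : ℝ) :
    Prop where
  mid : ∀ s ∈ D, ∀ t ∈ D, ∀ u ∈ D, s < t → t < u → dist s u < δ → x s = x t ∨ x t = x u
  left : ∀ s ∈ D, ∀ t ∈ D, (s : ℝ) < δ → (t : ℝ) < δ → x s = x t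
  right : ∀ s ∈ D, ∀ t ∈ D, T - δ < s → T - δ < t → (s : ℝ) < T → (t : ℝ) < T → x s = x t

omit [T1Space E] in
theorem IsSeparatedOn.mono {D : Set (Icc (0 : ℝ) T)} {δ δ' : ℝ} (h : IsSeparatedOn x D δ)
    (hδ : δ' ≤ δ) : IsSeparatedOn x D δ' where
  mid s hs t ht u hu h1 h2 h3 := h.mid s hs t ht u hu h1 h2 (h3.trans_le hδ)
  left s hs t ht h1 h2 := h.left s hs t ht (h1.trans_le hδ) (h2.trans_le hδ)
  right s hs t ht h1 h2 := h.right s hs t ht (by linarith) (by linarith)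

theorem _root_.IsCompact.exists_ball_subset_of_mem_nhds {α : Type*} [PseudoMetricSpace α]
    {K : Set α} (hK : IsCompact K) {U : α → Set α} (hU : ∀ a ∈ K, U a ∈ 𝓝 a) :
    ∃ δ > 0, ∀ a ∈ K, ∃ b, Metric.ball a δ ⊆ U b := by
  obtain ⟨V, hV, h⟩ := lebesgue_number_lemma_nhds hK hU
  obtain ⟨δ, hδ, hδV⟩ := Metric.mem_uniformity_dist.1 hV
  refine ⟨δ, hδ, fun a ha => (h a ha).imp fun b hb => Subset.trans (fun c hc => ?_) hb⟩
  exact hδV (by rwa [dist_comm])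

/-- Near each `r` the path has one value before `r` and one value from `r` on. A Lebesgue number for
these neighbourhoods puts `s < t < u` into a single one, where at most one change occurs. The
windows at the ends come from right continuity at `0` and the left limit at `T`. -/
theorem exists_isSeparatedOn (hT : 0 < T) (hS : S.Finite) (hx : ∀ t, x t ∈ S) :
    ∃ δ > 0, IsSeparatedOn x univ δ := by
  have h1 : ∃ δ > 0, ∀ s t u, s < t → t < u → dist s u < δ → x s = x t ∨ x t = x u := by
    have hc : ∀ t : Icc (0 : ℝ) T, ∃ l, ∀ᶠ s in 𝓝 t, (s < t → x s = l) ∧ (t ≤ s → x s = x t) := by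
      intro t
      obtain ⟨l, hl⟩ := eventually_eq_left hS hx t
      exact ⟨l, (eventually_nhdsWithin_iff.1 hl).and
        (eventually_nhdsWithin_iff.1 (eventually_eq_right hS hx t))⟩
    choose l hl using hc
    obtain ⟨δ, hδ, h⟩ := isCompact_univ.exists_ball_subset_of_mem_nhds
      fun t _ => hl t
    refine ⟨δ, hδ, fun s t u hst htu hsu => ?_⟩
    obtain ⟨r, hr⟩ := h s (mem_univ s)
    have hsr := hr (Metric.mem_ball_self hδ)
    have hur := hr (show u ∈ Metric.ball s δ by rwa [Metric.mem_ball, dist_comm])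
    have htr := hr (show t ∈ Metric.ball s δ by
      rw [Metric.mem_ball]
      refine lt_of_le_of_lt ?_ hsu
      rw [Subtype.dist_eq, Subtype.dist_eq, Real.dist_eq, Real.dist_eq,
        abs_of_pos (sub_pos.2 (Subtype.coe_lt_coe.2 hst)), abs_sub_comm,
        abs_of_pos (sub_pos.2 (Subtype.coe_lt_coe.2 (hst.trans htu)))]
      linarith [Subtype.coe_lt_coe.2 htu])
    rcases lt_or_ge t r with htr' | htr'
    · exact Or.inl ((hsr.1 (hst.trans htr')).trans (htr.1 htr').symm)
    · exact Or.inr ((htr.2 htr').trans (hur.2 (htr'.trans htu.le)).symm)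
  have h2 : ∃ δ > 0, ∀ s : Icc (0 : ℝ) T, (s : ℝ) < δ → x s = x ⟨0, le_rfl, hT.le⟩ := by
    obtain ⟨δ, hδ, h⟩ := Metric.eventually_nhds_iff.1
      (eventually_nhdsWithin_iff.1 (eventually_eq_right hS hx ⟨0, le_rfl, hT.le⟩))
    refine ⟨δ, hδ, fun s hs => h ?_ s.2.1⟩
    rw [Subtype.dist_eq, Real.dist_eq, sub_zero, abs_of_nonneg s.2.1]
    exact hs
  have h3 : ∃ δ > 0, ∃ l, ∀ s : Icc (0 : ℝ) T, T - δ < s → (s : ℝ) < T → x s = l := by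
    obtain ⟨l, hl⟩ := eventually_eq_left hS hx ⟨T, hT.le, le_rfl⟩
    obtain ⟨δ, hδ, h⟩ := Metric.eventually_nhds_iff.1 (eventually_nhdsWithin_iff.1 hl)
    refine ⟨δ, hδ, l, fun s hs hs' => h ?_ hs'⟩
    rw [Subtype.dist_eq, Real.dist_eq, abs_sub_comm, abs_of_pos (sub_pos.2 hs')]
    linarith
  obtain ⟨δ₁, hδ₁, h1⟩ := h1
  obtain ⟨δ₂, hδ₂, h2⟩ := h2
  obtain ⟨δ₃, hδ₃, l, h3⟩ := h3
  have e1 : min δ₁ (min δ₂ δ₃) ≤ δ₁ := min_le_left _ _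
  have e2 : min δ₁ (min δ₂ δ₃) ≤ δ₂ := (min_le_right _ _).trans (min_le_left _ _)
  have e3 : min δ₁ (min δ₂ δ₃) ≤ δ₃ := (min_le_right _ _).trans (min_le_right _ _)
  refine ⟨min δ₁ (min δ₂ δ₃), lt_min hδ₁ (lt_min hδ₂ hδ₃), ?_, ?_, ?_⟩
  · exact fun s _ t _ u _ hst htu hsu => h1 s t u hst htu (hsu.trans_le e1)
  · exact fun s _ t _ hs ht => (h2 s (hs.trans_le e2)).trans (h2 t (ht.trans_le e2)).symm
  · exact fun s _ t _ hs ht hs' ht' =>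
      (h3 s (by linarith) hs').trans (h3 t (by linarith) ht').symm

/-- `D` meets every right neighbourhood. -/
def IsRightDense (D : Set (Icc (0 : ℝ) T)) : Prop := ∀ t, ∃ᶠ s in 𝓝[≥] t, s ∈ D

/-- A right-continuous path with finitely many values is constant just after each time, so any time
can be pushed slightly to the right into `D` without changing the value. -/
theorem IsSeparatedOn.univ_of_isRightDense (hS : S.Finite) (hx : ∀ t, x t ∈ S)
    {D : Set (Icc (0 : ℝ) T)} (hD : IsRightDense D) {δ : ℝ} (h : IsSeparatedOn x D δ) :
    IsSeparatedOn x univ δ := by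
  have key : ∀ t : Icc (0 : ℝ) T, ∀ p : Icc (0 : ℝ) T → Prop, (∀ᶠ s in 𝓝 t, p s) →
      ∃ d ∈ D, t ≤ d ∧ p d ∧ x d = x t := by
    intro t p hp
    obtain ⟨d, hd, hd1, hd2, hd3⟩ := ((hD t).and_eventually
      (((eventually_eq_right hS hx t).and self_mem_nhdsWithin).and
        (mem_nhdsWithin_of_mem_nhds hp))).exists.imp fun d hd =>
          (⟨hd.1, hd.2.1.1, hd.2.1.2, hd.2.2⟩ : d ∈ D ∧ x d = x t ∧ t ≤ d ∧ p d)
    exact ⟨d, hd, hd2, hd3, hd1⟩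
  refine ⟨?_, ?_, ?_⟩
  · intro s _ t _ u _ hst htu hsu
    -- The times are moved in the order `u`, `t`, `s`, so that the last move can preserve `dist s'
    -- u' < δ` for the `u'` already chosen.
    have hu : ∀ᶠ u' in 𝓝 u, dist s u' < δ :=
      (continuous_const.dist continuous_id).continuousAt.eventually_lt continuousAt_const hsu
    obtain ⟨u', hu'D, huu', hu'1, hu'x⟩ := key u _ hu
    obtain ⟨t', ht'D, htt', ht'1, ht'x⟩ := key t (fun r => r < u) (Iio_mem_nhds htu)
    have hs : ∀ᶠ s' in 𝓝 s, s' < t ∧ dist s' u' < δ :=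
      (eventually_lt_nhds hst).and
      ((continuous_id.dist continuous_const).continuousAt.eventually_lt continuousAt_const hu'1)
    obtain ⟨s', hs'D, hss', hs'1, hs'x⟩ := key s _ hs
    rw [← hu'x, ← ht'x, ← hs'x]
    exact h.mid s' hs'D t' ht'D u' hu'D (hs'1.1.trans_le htt') (ht'1.trans_le huu') hs'1.2
  · intro s _ t _ hs ht
    obtain ⟨s', hs'D, -, hs'1, hs'x⟩ := key s (fun r => (r : ℝ) < δ)
      (continuous_subtype_val.continuousAt.eventually_lt continuousAt_const hs)
    obtain ⟨t', ht'D, -, ht'1, ht'x⟩ := key t (fun r => (r : ℝ) < δ)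
      (continuous_subtype_val.continuousAt.eventually_lt continuousAt_const ht)
    rw [← hs'x, ← ht'x]
    exact h.left s' hs'D t' ht'D hs'1 ht'1
  · intro s _ t _ hs ht hs1 ht1
    obtain ⟨s', hs'D, hss', hs'1, hs'x⟩ := key s (fun r => (r : ℝ) < T)
      (continuous_subtype_val.continuousAt.eventually_lt continuousAt_const hs1)
    obtain ⟨t', ht'D, htt', ht'1, ht'x⟩ := key t (fun r => (r : ℝ) < T)
      (continuous_subtype_val.continuousAt.eventually_lt continuousAt_const ht1)
    rw [← hs'x, ← ht'x]
    exact h.right s' hs'D t' ht'D (hs.trans_le hss') (ht.trans_le htt') hs'1 ht'1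

theorem frequently_ne_of_not_continuousAt (hS : S.Finite) (hx : ∀ t, x t ∈ S)
    {t : Icc (0 : ℝ) T} (ht : ¬ ContinuousAt x t) : ∃ᶠ s in 𝓝[<] t, x s ≠ x t := by
  intro h
  refine ht ((tendsto_congr' ?_).2 (tendsto_const_nhds (x := x t)))
  simp only [not_not] at h
  filter_upwards [eventually_nhdsWithin_iff.1 h,
    eventually_nhdsWithin_iff.1 (eventually_eq_right hS hx t)] with s h1 h2
  rcases lt_or_ge s t with h | h
  · exact h1 h
  · exact h2 h

/-- The path is continuous on the connected interval `Icc a b`, at `a` by right continuity, and maps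
it to a finite, hence discrete, set. -/
theorem eq_of_continuousAt (hS : S.Finite) (hx : ∀ t, x t ∈ S) {a b : Icc (0 : ℝ) T}
    (hab : a ≤ b) (h : ∀ t, a < t → t ≤ b → ContinuousAt x t) : x a = x b := by
  have : DiscreteTopology S := @Finite.instDiscreteTopology _ _ _ hS.to_subtype
  have hpre : IsPreconnected (Icc a b) := by
    refine (IsInducing.subtypeVal.isPreconnected_image).1 ?_
    have : Subtype.val '' Icc a b = Icc (a : ℝ) b := by
      ext r
      constructor
      · rintro ⟨s, hs, rfl⟩
        exact hs
      · intro hr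
        exact ⟨⟨r, a.2.1.trans hr.1, hr.2.trans b.2.2⟩, hr, rfl⟩
    rw [this]
    exact isPreconnected_Icc
  refine hpre.constant_of_mapsTo (T := S) (isDiscrete_iff_discreteTopology.2 this) ?_
    (fun t _ => hx t) (left_mem_Icc.2 hab) (right_mem_Icc.2 hab)
  intro t ht
  rcases ht.1.eq_or_lt with rfl | hlt
  · exact (x.isCadlag _).1.mono Icc_subset_Ici_self
  · exact (h t hlt ht.2).continuousWithinAt

/-- The jump times are the discontinuities. Separation makes them `δ`-apart, so `⌊t / δ⌋₊` is
injective on them and takes values in `0, …, ⌊T / δ⌋₊`, which bounds their number. Between them the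
path is constant, so its value depends only on the set of past jumps. -/
theorem IsSeparatedOn.mem_stepPaths (hT : 0 < T) (hS : S.Finite) (hx : ∀ t, x t ∈ S) {δ : ℝ}
    (hδ : 0 < δ) (h : IsSeparatedOn x univ δ) : x ∈ stepPaths T S δ (⌊T / δ⌋₊ + 1) := by
  let J : Set (Icc (0 : ℝ) T) := {t | ¬ ContinuousAt x t}
  have hleft : ∀ t ∈ J, ∀ a < t, ∃ s, a < s ∧ s < t ∧ x s ≠ x t := by
    intro t ht a hat
    obtain ⟨s, hs1, hs2, hs3⟩ := ((frequently_ne_of_not_continuousAt hS hx ht).and_eventually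
      (((eventually_gt_nhds hat).filter_mono nhdsWithin_le_nhds).and self_mem_nhdsWithin)).exists
    exact ⟨s, hs2, hs3, hs1⟩
  have hleft' : ∀ t ∈ J, ∃ s, s < t ∧ x s ≠ x t := by
    intro t ht
    obtain ⟨s, hs1, hs2⟩ := ((frequently_ne_of_not_continuousAt hS hx ht).and_eventually
      self_mem_nhdsWithin).exists
    exact ⟨s, hs2, hs1⟩
  have hsep' : ∀ a ∈ J, ∀ b ∈ J, a < b → δ ≤ (b : ℝ) - a := by
    intro a ha b hb hab
    by_contra! hlt
    -- A value different from `x a` is taken just before `a`, still within `δ` of `b`. Then `mid`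
    -- forces `x` to be constant on `[a, b]`, against the jump at `b`. The time `b - δ` may be
    -- negative, hence the two cases.
    obtain ⟨s, hsa, hsb, hne⟩ : ∃ s : Icc (0 : ℝ) T, (b : ℝ) - δ < s ∧ s < a ∧ x s ≠ x a := by
      rcases lt_or_ge ((b : ℝ) - δ) 0 with h0 | h0
      · obtain ⟨s, hs, hne⟩ := hleft' a ha
        exact ⟨s, h0.trans_le s.2.1, hs, hne⟩
      · obtain ⟨s, hs1, hs2, hne⟩ := hleft a ha ⟨(b : ℝ) - δ, h0, by linarith [b.2.2]⟩
          (Subtype.coe_lt_coe.1 (by simp only; linarith))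
        exact ⟨s, hs1, hs2, hne⟩
    have hd : ∀ t : Icc (0 : ℝ) T, a < t → t ≤ b → x a = x t := by
      intro t hat htb
      refine (h.mid s trivial a trivial t trivial hsb hat ?_).resolve_left hne
      rw [dist_comm, Subtype.dist_eq, Real.dist_eq,
        abs_of_pos (sub_pos.2 (Subtype.coe_lt_coe.2 (hsb.trans hat)))]
      have := Subtype.coe_le_coe.2 htb
      linarith
    obtain ⟨t, hat, htb, hne'⟩ := hleft b hb a hab
    exact hne' ((hd t hat htb.le).symm.trans (hd b hab le_rfl))
  have hsep : ∀ a ∈ J, ∀ b ∈ J, a ≠ b → δ ≤ |(a : ℝ) - b| := by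
    intro a ha b hb hab
    rcases lt_or_gt_of_ne hab with h1 | h1
    · rw [abs_sub_comm]
      exact (hsep' a ha b hb h1).trans (le_abs_self _)
    · exact (hsep' b hb a ha h1).trans (le_abs_self _)
  have hJ0 : ∀ t ∈ J, δ ≤ t := by
    intro t ht
    by_contra! hlt
    obtain ⟨s, hs, hne⟩ := hleft' t ht
    exact hne (h.left s trivial t trivial ((Subtype.coe_lt_coe.2 hs).trans hlt) hlt)
  have hJT : ∀ t ∈ J, (t : ℝ) ≤ T - δ ∨ (t : ℝ) = T := by
    intro t ht
    by_contra! hcon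
    have hlt : (t : ℝ) < T := lt_of_le_of_ne t.2.2 hcon.2
    have h0 := hJ0 t ht
    have hm : (0 : ℝ) ≤ max 0 (T - δ) ∧ max 0 (T - δ) ≤ T :=
      ⟨le_max_left _ _, max_le hT.le (by linarith)⟩
    obtain ⟨s, hs1, hs2, hne⟩ := hleft t ht ⟨max 0 (T - δ), hm⟩
      (Subtype.coe_lt_coe.1 (max_lt (by linarith) hcon.1))
    have hs1' : max 0 (T - δ) < s := hs1
    exact hne (h.right s trivial t trivial ((le_max_right _ _).trans_lt hs1') hcon.1
      ((Subtype.coe_lt_coe.2 hs2).trans hlt) hlt)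
  have hmaps : MapsTo (fun t : Icc (0 : ℝ) T => ⌊(t : ℝ) / δ⌋₊) J (Iio (⌊T / δ⌋₊ + 1)) := by
    intro t _
    exact Nat.lt_succ_of_le (Nat.floor_mono (by have := t.2.2; gcongr))
  have hinj : InjOn (fun t : Icc (0 : ℝ) T => ⌊(t : ℝ) / δ⌋₊) J := by
    intro a ha b hb hab
    by_contra hne
    have h1 := hsep a ha b hb hne
    have ha1 := Nat.floor_le (div_nonneg a.2.1 hδ.le)
    have ha2 := Nat.lt_floor_add_one ((a : ℝ) / δ)
    have hb1 := Nat.floor_le (div_nonneg b.2.1 hδ.le)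
    have hb2 := Nat.lt_floor_add_one ((b : ℝ) / δ)
    simp only at hab
    rw [hab] at ha1 ha2
    have h2 : |(a : ℝ) / δ - b / δ| < 1 := abs_lt.2 ⟨by linarith, by linarith⟩
    rw [← sub_div, abs_div, abs_of_pos hδ, div_lt_one hδ] at h2
    linarith
  have hJfin : J.Finite := Set.Finite.of_injOn hmaps hinj (finite_Iio _)
  have hcard : J.ncard ≤ ⌊T / δ⌋₊ + 1 := by
    have := ncard_le_ncard_of_injOn _ hmaps hinj (finite_Iio _)
    simpa using this
  have := hJfin.to_subtype
  let e : J ≃ Fin J.ncard := Finite.equivFin J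
  let t : Fin J.ncard → Icc (0 : ℝ) T := fun i => (e.symm i : Icc (0 : ℝ) T)
  have htJ : ∀ i, t i ∈ J := fun i => (e.symm i).2
  have hfac : ∀ a b, a ≤ b → jumpsBefore t a = jumpsBefore t b →
      x a = x b := by
    intro a b hab heq
    refine eq_of_continuousAt hS hx hab fun r har hrb => ?_
    by_contra hr
    have h1 : e ⟨r, hr⟩ ∈ jumpsBefore t b := by simpa [t, jumpsBefore] using hrb
    rw [← heq] at h1
    have h2 : r ≤ a := by simpa [t, jumpsBefore] using h1
    exact absurd har (not_lt.2 h2)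
  -- The default value is irrelevant except that it must lie in `S`.
  let σ : Finset (Fin J.ncard) → E := Function.extend
    (fun s : Icc (0 : ℝ) T => jumpsBefore t s) x
    fun _ => x ⟨0, le_rfl, hT.le⟩
  have hσx : ∀ s, σ (jumpsBefore t s) = x s := by
    intro s
    refine Function.FactorsThrough.extend_apply
      (f := fun s : Icc (0 : ℝ) T => jumpsBefore t s)
      (fun a b hab => ?_) _ s
    rcases le_total a b with h1 | h1
    · exact hfac a b h1 hab
    · exact (hfac b a h1 hab.symm).symm
  have hσS : ∀ A, σ A ∈ S := by
    intro A
    by_cases hA : ∃ s, jumpsBefore t s = A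
    · obtain ⟨s, rfl⟩ := hA
      rw [hσx]
      exact hx s
    · simp only [σ]
      rw [Function.extend_apply' _ _ _ hA]
      exact hx _
  refine mem_iUnion₂.2 ⟨J.ncard, hcard, mem_iUnion₂.2 ⟨σ, hσS, t, ⟨?_, ?_⟩, ?_⟩⟩
  · intro i j hij
    exact hsep _ (htJ i) _ (htJ j) fun h => hij (e.symm.injective (Subtype.ext h))
  · exact fun i => ⟨hJ0 _ (htJ i), hJT _ (htJ i)⟩
  · exact CadlagPath.ext (funext hσx)

end FiniteValued

/-! ### Exponentials of generators -/

section Semigroup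

variable {S : Type*} [Fintype S]

/-- After a shift by a multiple of the identity, `A` becomes a positive operator `Q`; then `Q ^ n h`
is bounded term by term in the exponential series, and the commuting shift is undone. No sign is
imposed on `h`: negative `h` yields `exp_apply_nonneg`, and `h = ±1` yields `exp_apply_one`. -/
theorem exp_apply_le_of_apply_le {A : (S → ℝ) →L[ℝ] (S → ℝ)} {c : ℝ}
    (hA : ∀ f, 0 ≤ f → 0 ≤ A f + c • f) {h : S → ℝ} {B : ℝ} (hB : A h ≤ B • h) {t : ℝ}
    (ht : 0 ≤ t) : NormedSpace.exp (t • A) h ≤ Real.exp (t * B) • h := by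
  let _ : NormedAlgebra ℚ ((S → ℝ) →L[ℝ] (S → ℝ)) := .restrictScalars ℚ ℝ _
  -- The second entry makes `B + c' ≥ 0`, so that multiplying by its powers preserves inequalities.
  let c' := max c (-B)
  let Q : (S → ℝ) →L[ℝ] (S → ℝ) := t • A + algebraMap ℝ _ (t * c')
  have hQ : ∀ f, Q f = t • (A f + c' • f) := fun f => by
    simp [Q, Algebra.algebraMap_eq_smul_one, smul_smul]
  have hQ0 : ∀ f, 0 ≤ f → 0 ≤ Q f := fun f hf => by
    rw [hQ]
    refine smul_nonneg ht ((hA f hf).trans ?_)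
    gcongr
    exact le_max_left _ _
  have hQm : ∀ f g, f ≤ g → Q f ≤ Q g := fun f g hfg => by
    have := hQ0 (g - f) (sub_nonneg.2 hfg)
    rwa [map_sub, sub_nonneg] at this
  have hb0 : 0 ≤ t * (B + c') := mul_nonneg ht (by linarith [le_max_right c (-B)])
  have hQh : Q h ≤ (t * (B + c')) • h := by
    rw [hQ, mul_smul, add_smul]
    gcongr
  have hpow : ∀ n : ℕ, (Q ^ n) h ≤ (t * (B + c')) ^ n • h := by
    intro n
    induction n with
    | zero => simp
    | succ n ih =>
      rw [pow_succ']
      refine (hQm _ _ ih).trans ?_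
      rw [map_smul, pow_succ, mul_smul]
      gcongr
  have hexpQ : NormedSpace.exp Q h ≤ Real.exp (t * (B + c')) • h := by
    intro i
    have h1 : HasSum (fun n : ℕ => ((n.factorial : ℝ)⁻¹ • Q ^ n) h i) (NormedSpace.exp Q h i) :=
      ((NormedSpace.exp_series_hasSum_exp' (𝕂 := ℝ) Q).mapL
        (ContinuousLinearMap.apply ℝ (S → ℝ) h)).mapL (ContinuousLinearMap.proj (R := ℝ) i)
    have h2 : HasSum (fun n : ℕ => ((n.factorial : ℝ)⁻¹ • (t * (B + c')) ^ n) * h i)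
        (Real.exp (t * (B + c')) * h i) := by
      rw [Real.exp_eq_exp_ℝ]
      exact (NormedSpace.exp_series_hasSum_exp' (𝕂 := ℝ) (t * (B + c'))).mul_right _
    refine hasSum_le (fun n => ?_) h1 h2
    have h3 := hpow n i
    simp only [Pi.smul_apply, smul_eq_mul, _root_.smul_apply] at h3 ⊢
    rw [mul_assoc]
    gcongr
  have hsplit : t • A = Q + algebraMap ℝ _ (-(t * c')) := by simp [Q]
  rw [hsplit, NormedSpace.exp_add_of_commute (Algebra.commutes _ _).symm,
    ← NormedSpace.algebraMap_exp_comm, ← Real.exp_eq_exp_ℝ, Algebra.algebraMap_eq_smul_one]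
  have h4 : (NormedSpace.exp Q * Real.exp (-(t * c')) • (1 : (S → ℝ) →L[ℝ] (S → ℝ))) h =
      Real.exp (-(t * c')) • NormedSpace.exp Q h := by simp
  rw [h4]
  calc Real.exp (-(t * c')) • NormedSpace.exp Q h
      ≤ Real.exp (-(t * c')) • Real.exp (t * (B + c')) • h := by gcongr
    _ = Real.exp (t * B) • h := by
        rw [smul_smul, ← Real.exp_add]
        congr 2
        ring

theorem exp_apply_nonneg {A : (S → ℝ) →L[ℝ] (S → ℝ)} {c : ℝ}
    (hA : ∀ f, 0 ≤ f → 0 ≤ A f + c • f) {f : S → ℝ} (hf : 0 ≤ f) {t : ℝ} (ht : 0 ≤ t) :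
    0 ≤ NormedSpace.exp (t • A) f := by
  have h1 : A (-f) ≤ (-c) • (-f) := by
    have := hA f hf
    rw [map_neg, neg_smul_neg]
    exact neg_le_iff_add_nonneg'.2 (by rwa [add_comm] at this ⊢)
  have h2 := exp_apply_le_of_apply_le hA h1 ht
  rw [map_neg, smul_neg, neg_le_neg_iff] at h2
  exact (smul_nonneg (Real.exp_pos _).le hf).trans h2

theorem exp_apply_one {A : (S → ℝ) →L[ℝ] (S → ℝ)} {c : ℝ}
    (hA : ∀ f, 0 ≤ f → 0 ≤ A f + c • f) (h1 : A 1 = 0) {t : ℝ} (ht : 0 ≤ t) :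
    NormedSpace.exp (t • A) 1 = 1 := by
  refine le_antisymm ?_ ?_
  · simpa using exp_apply_le_of_apply_le (h := 1) (B := 0) hA (by simp [h1]) ht
  · simpa using exp_apply_le_of_apply_le (h := -1) (B := 0) hA (by simp [h1]) ht

end Semigroup

/-! ### A maximal inequality for finite Markov chains -/

section Chain

variable {S : Type*} [Fintype S]

theorem sum_fin_succ_pi {M : Type*} [AddCommMonoid M] {n : ℕ} (F : (Fin (n + 1) → S) → M) :
    ∑ τ, F τ = ∑ ζ, ∑ τ : Fin n → S, F (Fin.cons ζ τ) := by
  rw [← Fintype.sum_prod_type']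
  exact (Fintype.sum_equiv (Fin.consEquiv fun _ => S) _ _ fun _ => rfl).symm

/-- The weight of a path of a Markov chain with transition probabilities `q`. -/
def pathWeight {n : ℕ} (q : Fin n → S → S → ℝ≥0∞) (σ : Fin (n + 1) → S) : ℝ≥0∞ :=
  ∏ i, q i (σ i.castSucc) (σ i.succ)

omit [Fintype S] in
theorem pathWeight_cons {n : ℕ} (q : Fin (n + 1) → S → S → ℝ≥0∞) (η : S)
    (σ : Fin (n + 1) → S) :
    pathWeight q (Fin.cons η σ : Fin (n + 2) → S) =
      q 0 η (σ 0) * pathWeight (fun i => q i.succ) σ := by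
  simp [pathWeight, Fin.prod_univ_succ (n := n)]

theorem sum_pathWeight {n : ℕ} (q : Fin n → S → S → ℝ≥0∞) (hq : ∀ i η, ∑ ζ, q i η ζ = 1)
    (η : S) : ∑ τ : Fin n → S, pathWeight q (Fin.cons η τ : Fin (n + 1) → S) = 1 := by
  induction n generalizing η with
  | zero => simp [pathWeight]
  | succ n ih =>
    simp only [sum_fin_succ_pi, pathWeight_cons, Fin.cons_zero, ← Finset.mul_sum]
    simp only [ih (fun i => q i.succ) (fun i => hq _), mul_one, hq]

open scoped Classical in
-- Doob's maximal inequality for `h` along the chain, which is a supermartingale up to the factors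
-- `ρ`. If the level is reached at the start, the total weight one suffices; otherwise it is reached
-- after the first step, and one conditions on that step.
theorem sum_pathWeight_exists_le {n : ℕ} (q : Fin n → S → S → ℝ≥0∞)
    (hq : ∀ i η, ∑ ζ, q i η ζ = 1) {h : S → ℝ≥0∞} {ρ : Fin n → ℝ≥0∞} (hρ : ∀ i, 1 ≤ ρ i)
    (hqh : ∀ i η, ∑ ζ, q i η ζ * h ζ ≤ ρ i * h η) (a : ℝ≥0∞) (η : S) :
    (∑ τ : Fin n → S, if ∃ i, a ≤ h ((Fin.cons η τ : Fin (n + 1) → S) i) then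
      pathWeight q (Fin.cons η τ : Fin (n + 1) → S) else 0) * a ≤ (∏ i, ρ i) * h η := by
  by_cases ha : a ≤ h η
  · refine mul_le_mul' (le_trans ?_ (Finset.one_le_prod' fun i _ => hρ i)) ha
    rw [← sum_pathWeight q hq η]
    refine Finset.sum_le_sum fun τ _ => ?_
    split_ifs <;> simp
  induction n generalizing η with
  | zero => simp [ha]
  | succ n ih =>
    have ih' : ∀ ζ, (∑ τ : Fin n → S, if ∃ i, a ≤ h ((Fin.cons ζ τ : Fin (n + 1) → S) i) then
        pathWeight (fun i => q i.succ) (Fin.cons ζ τ : Fin (n + 1) → S) else 0) * a ≤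
          (∏ i : Fin n, ρ i.succ) * h ζ := by
      intro ζ
      by_cases hζ : a ≤ h ζ
      · refine mul_le_mul' (le_trans ?_ (Finset.one_le_prod' fun i _ => hρ i.succ)) hζ
        rw [← sum_pathWeight (fun i => q i.succ) (fun i => hq _) ζ]
        refine Finset.sum_le_sum fun τ _ => ?_
        split_ifs <;> simp
      · exact ih (fun i => q i.succ) (fun i => hq _) (fun i => hρ _) (fun i => hqh _) ζ hζ
    have hex : ∀ σ : Fin (n + 1) → S, (∃ i, a ≤ h ((Fin.cons η σ : Fin (n + 2) → S) i)) ↔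
        ∃ i, a ≤ h (σ i) := by
      intro σ
      rw [Fin.exists_fin_succ]
      simp [ha]
    simp only [hex, sum_fin_succ_pi, pathWeight_cons, Fin.cons_zero]
    have hpull : ∀ ζ, (∑ τ : Fin n → S,
        if ∃ i, a ≤ h ((Fin.cons ζ τ : Fin (n + 1) → S) i) then
          q 0 η ζ * pathWeight (fun i => q i.succ) (Fin.cons ζ τ : Fin (n + 1) → S) else 0) =
        q 0 η ζ * ∑ τ : Fin n → S, if ∃ i, a ≤ h ((Fin.cons ζ τ : Fin (n + 1) → S) i) then
          pathWeight (fun i => q i.succ) (Fin.cons ζ τ : Fin (n + 1) → S) else 0 := by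
      intro ζ
      rw [Finset.mul_sum]
      exact Finset.sum_congr rfl fun τ _ => by split_ifs <;> simp
    simp only [hpull]
    rw [Finset.sum_mul]
    simp only [mul_assoc]
    calc ∑ ζ, q 0 η ζ * ((∑ τ : Fin n → S,
            if ∃ i, a ≤ h ((Fin.cons ζ τ : Fin (n + 1) → S) i) then
              pathWeight (fun i => q i.succ) (Fin.cons ζ τ : Fin (n + 1) → S) else 0) * a)
        ≤ ∑ ζ, q 0 η ζ * ((∏ i : Fin n, ρ i.succ) * h ζ) := by
          refine Finset.sum_le_sum fun ζ _ => mul_le_mul_right (ih' ζ) _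
      _ = (∏ i : Fin n, ρ i.succ) * ∑ ζ, q 0 η ζ * h ζ := by
          rw [Finset.mul_sum]
          exact Finset.sum_congr rfl fun ζ _ => by ring
      _ ≤ (∏ i : Fin n, ρ i.succ) * (ρ 0 * h η) := by
          gcongr
          exact hqh 0 η
      _ = (∏ i, ρ i) * h η := by
          rw [Fin.prod_univ_succ]
          ring

end Chain

/-! ### Oscillations of the exclusion process -/

section Law

variable {k : ℕ} {b : Fin k → UnitAddCircle} {β : ℝ} {N : ℕ+}

theorem conductance_nonneg (x : ZMod (N : ℕ)) : 0 ≤ conductance b β N x := by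
  unfold conductance
  split_ifs
  · positivity
  · exact zero_le_one

theorem generator_apply (f : Config N → ℝ) (η : Config N) :
    generator b β N f η = ∑ x : ZMod (N : ℕ), conductance b β N x * (f (exchange η x) - f η) :=
  rfl

/-- Adding the total rate cancels the diagonal terms; only exchanges with nonnegative rates remain.
-/
theorem generator_add_nonneg (f : Config N → ℝ) (hf : 0 ≤ f) :
    0 ≤ generator b β N f + (∑ x : ZMod (N : ℕ), conductance b β N x) • f := by
  intro η
  simp only [Pi.zero_apply, Pi.add_apply, Pi.smul_apply, smul_eq_mul, generator_apply,
    Finset.sum_mul, ← Finset.sum_add_distrib]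
  refine Finset.sum_nonneg fun x _ => ?_
  have := mul_nonneg (conductance_nonneg (b := b) (β := β) x) (hf (exchange η x))
  linarith

theorem generator_one : generator b β N 1 = 0 := by
  ext η
  simp [generator_apply]

theorem sum_transitionProb_mul (t : ℝ) (g : Config N → ℝ) (η : Config N) :
    ∑ ζ, transitionProb b β N t η ζ * g ζ =
      NormedSpace.exp ((t * ((N : ℕ) : ℝ) ^ 2) • generator b β N) g η := by
  conv_rhs => rw [pi_eq_sum_univ' g]
  simp [transitionProb, mul_comm]

theorem transitionProb_nonneg {t : ℝ} (ht : 0 ≤ t) (η ζ : Config N) :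
    0 ≤ transitionProb b β N t η ζ :=
  exp_apply_nonneg generator_add_nonneg (Pi.single_nonneg.2 zero_le_one) (by positivity) η

theorem sum_ofReal_transitionProb_mul {t : ℝ} (ht : 0 ≤ t) {g : Config N → ℝ} (hg : 0 ≤ g)
    (η : Config N) :
    ∑ ζ, ENNReal.ofReal (transitionProb b β N t η ζ) * ENNReal.ofReal (g ζ) =
      ENNReal.ofReal (NormedSpace.exp ((t * ((N : ℕ) : ℝ) ^ 2) • generator b β N) g η) := by
  rw [← sum_transitionProb_mul, ENNReal.ofReal_sum_of_nonneg
    fun ζ _ => mul_nonneg (transitionProb_nonneg ht η ζ) (hg ζ)]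
  exact Finset.sum_congr rfl fun ζ _ => (ENNReal.ofReal_mul (transitionProb_nonneg ht η ζ)).symm

theorem sum_ofReal_transitionProb {t : ℝ} (ht : 0 ≤ t) (η : Config N) :
    ∑ ζ, ENNReal.ofReal (transitionProb b β N t η ζ) = 1 := by
  have h := sum_ofReal_transitionProb_mul (b := b) (β := β) ht (g := 1) zero_le_one η
  rw [exp_apply_one generator_add_nonneg generator_one (by positivity)] at h
  simpa using h

variable {μ : Measure (Config N)} {P : Measure (CadlagPath ℝ≥0 (Config N))}

theorem measurable_eval {I E : Type*} [TopologicalSpace I] [LinearOrder I] [TopologicalSpace E]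
    [MeasurableSpace E] (t : I) : Measurable fun ω : CadlagPath I E => ω t :=
  (measurable_pi_apply t).comp (comap_measurable _)

theorem IsExclusionLaw.isProbabilityMeasure (hP : IsExclusionLaw b β N μ P)
    [IsProbabilityMeasure μ] : IsProbabilityMeasure P := by
  constructor
  have h0 : ∀ σ, P ((fun ω : CadlagPath ℝ≥0 (Config N) => ω 0) ⁻¹' {σ}) = μ {σ} := by
    intro σ
    have := hP 0 (fun _ => 0) (fun _ => σ) monotone_const rfl
    simpa [preimage] using this
  have h1 := sum_measure_preimage_singleton (μ := P) (Finset.univ : Finset (Config N))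
    (f := fun ω : CadlagPath ℝ≥0 (Config N) => ω 0)
    fun σ _ => measurable_eval 0 (measurableSet_singleton σ)
  simp only [h0, sum_measure_singleton, Finset.coe_univ, preimage_univ, measure_univ] at h1
  exact h1.symm

/-- The defining formula requires the first time to be `0`, so this time is prepended and the state
there summed out. The case of a single time identifies the resulting sum as the law at `t 0`. -/
theorem IsExclusionLaw.measure_forall_eq (hP : IsExclusionLaw b β N μ P) {n : ℕ}
    {t : Fin (n + 1) → ℝ≥0} (ht : Monotone t) (σ : Fin (n + 1) → Config N) :
    P {ω | ∀ i, ω (t i) = σ i} = P {ω | ω (t 0) = σ 0} *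
      pathWeight (fun i η ζ => ENNReal.ofReal (transitionProb b β N (t i.succ - t i.castSucc) η ζ))
        σ := by
  have key : ∀ (m : ℕ) (t : Fin (m + 1) → ℝ≥0) (_ : Monotone t) (σ : Fin (m + 1) → Config N),
      P {ω | ∀ i, ω (t i) = σ i} =
      (∑ ζ, μ {ζ} * ENNReal.ofReal (transitionProb b β N (t 0) ζ (σ 0))) *
      pathWeight (fun i η ζ => ENNReal.ofReal (transitionProb b β N (t i.succ - t i.castSucc) η ζ))
        σ := by
    intro m t ht σ
    have hmeas : ∀ ζ, MeasurableSet
        ((fun ω : CadlagPath ℝ≥0 (Config N) => ω 0) ⁻¹' {ζ}) :=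
      fun ζ => measurable_eval 0 (measurableSet_singleton ζ)
    have h1 := sum_measure_preimage_singleton (μ := P.restrict {ω | ∀ i, ω (t i) = σ i})
      (Finset.univ : Finset (Config N)) (f := fun ω : CadlagPath ℝ≥0 (Config N) => ω 0)
      fun σ _ => hmeas σ
    rw [Finset.coe_univ, preimage_univ, Measure.restrict_apply_univ] at h1
    rw [← h1, Finset.sum_mul]
    refine Finset.sum_congr rfl fun ζ _ => ?_
    have hmono : Monotone (Fin.cons 0 t : Fin (m + 2) → ℝ≥0) := by
      refine Fin.monotone_iff_le_succ.2 fun i => ?_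
      refine Fin.cases ?_ (fun j => ?_) i
      · simp
      · simpa using ht (Fin.castSucc_lt_succ (i := j)).le
    have h2 := hP (m + 1) (Fin.cons 0 t) (Fin.cons ζ σ) hmono rfl
    rw [Measure.restrict_apply (hmeas ζ)]
    have h3 : {ω : CadlagPath ℝ≥0 (Config N) | ∀ i, ω ((Fin.cons 0 t : Fin (m + 2) → ℝ≥0) i) =
        (Fin.cons ζ σ : Fin (m + 2) → Config N) i} =
        (fun ω : CadlagPath ℝ≥0 (Config N) => ω 0) ⁻¹' {ζ} ∩ {ω | ∀ i, ω (t i) = σ i} := by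
      ext ω
      simp [Fin.forall_fin_succ]
    rw [h3, Fin.prod_univ_succ] at h2
    rw [h2, mul_assoc]
    simp [pathWeight]
  rw [key n t ht σ]
  congr 1
  have := key 0 (fun _ => t 0) monotone_const (fun _ => σ 0)
  simpa [pathWeight] using this.symm

open scoped Classical in
-- The maximal inequality is applied to `exp (θ f)`, whose expectation grows at rate at most `B`.
-- The level `exp (θ (f η + ε))` depends on the starting state, so the estimate is made for each
-- value `η` of `ω (t 0)` and then averaged.
theorem IsExclusionLaw.measure_exists_grid_le (hP : IsExclusionLaw b β N μ P)
    [IsProbabilityMeasure μ] {f : Config N → ℝ} {θ B : ℝ} (hθ : 0 ≤ θ) (hB0 : 0 ≤ B)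
    (hB : ∀ η, ((N : ℕ) : ℝ) ^ 2 * generator b β N (fun ζ => Real.exp (θ * f ζ)) η ≤
      B * Real.exp (θ * f η)) {n : ℕ} {t : Fin (n + 1) → ℝ≥0} (ht : Monotone t) (ε : ℝ) :
    P {ω | ∃ i, f (ω (t 0)) + ε ≤ f (ω (t i))} ≤
      ENNReal.ofReal (Real.exp (B * (t (Fin.last n) - t 0) - θ * ε)) := by
  have := hP.isProbabilityMeasure
  let q : Fin n → Config N → Config N → ℝ≥0∞ := fun i η ζ =>
    ENNReal.ofReal (transitionProb b β N (t i.succ - t i.castSucc) η ζ)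
  let h : Config N → ℝ≥0∞ := fun ζ => ENNReal.ofReal (Real.exp (θ * f ζ))
  let ρ : Fin n → ℝ≥0∞ := fun i => ENNReal.ofReal (Real.exp (B * (t i.succ - t i.castSucc)))
  have hΔ : ∀ i : Fin n, (0 : ℝ) ≤ t i.succ - t i.castSucc := fun i =>
    sub_nonneg.2 (NNReal.coe_le_coe.2 (ht (Fin.castSucc_lt_succ (i := i)).le))
  have hq : ∀ i η, ∑ ζ, q i η ζ = 1 := fun i η => sum_ofReal_transitionProb (hΔ i) η
  have hρ : ∀ i, 1 ≤ ρ i := fun i => by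
    rw [← ENNReal.ofReal_one]
    exact ENNReal.ofReal_le_ofReal (Real.one_le_exp (mul_nonneg hB0 (hΔ i)))
  have hN : (0 : ℝ) < ((N : ℕ) : ℝ) ^ 2 := by
    have : (0 : ℝ) < (N : ℕ) := Nat.cast_pos.2 N.pos
    positivity
  have hqh : ∀ i η, ∑ ζ, q i η ζ * h ζ ≤ ρ i * h η := by
    intro i η
    simp only [q, h, ρ]
    rw [sum_ofReal_transitionProb_mul (hΔ i) (fun ζ => (Real.exp_pos _).le),
      ← ENNReal.ofReal_mul (Real.exp_pos _).le]
    refine ENNReal.ofReal_le_ofReal ?_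
    have hB' : generator b β N (fun ζ => Real.exp (θ * f ζ)) ≤
        (B / ((N : ℕ) : ℝ) ^ 2) • fun ζ => Real.exp (θ * f ζ) := by
      intro ζ
      simp only [Pi.smul_apply, smul_eq_mul]
      rw [div_mul_eq_mul_div, le_div_iff₀ hN, mul_comm]
      exact hB ζ
    have h1 := exp_apply_le_of_apply_le generator_add_nonneg hB'
      (mul_nonneg (hΔ i) hN.le) η
    simp only [Pi.smul_apply, smul_eq_mul] at h1
    refine h1.trans (le_of_eq ?_)
    congr 2
    field_simp
  have hprod : ∏ i, ρ i = ENNReal.ofReal (Real.exp (B * (t (Fin.last n) - t 0))) := by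
    simp only [ρ]
    rw [← ENNReal.ofReal_prod_of_nonneg fun i _ => (Real.exp_pos _).le, ← Real.exp_sum,
      ← Finset.mul_sum]
    congr 3
    have e1 := Fin.sum_univ_succ fun i => (t i : ℝ)
    have e2 := Fin.sum_univ_castSucc fun i => (t i : ℝ)
    rw [Finset.sum_sub_distrib]
    linarith
  have hbad : ∀ η, (∑ τ : Fin n → Config N,
      if ∃ i, f η + ε ≤ f ((Fin.cons η τ : Fin (n + 1) → Config N) i) then
        pathWeight q (Fin.cons η τ : Fin (n + 1) → Config N) else 0) ≤
      ENNReal.ofReal (Real.exp (B * (t (Fin.last n) - t 0) - θ * ε)) := by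
    intro η
    have h1 := sum_pathWeight_exists_le q hq hρ hqh
      (ENNReal.ofReal (Real.exp (θ * (f η + ε)))) η
    have ha0 : ENNReal.ofReal (Real.exp (θ * (f η + ε))) ≠ 0 := by
      simpa using Real.exp_pos _
    rw [← ENNReal.mul_le_mul_iff_left ha0 ENNReal.ofReal_ne_top]
    refine le_trans ?_ (h1.trans (le_of_eq ?_))
    · gcongr with τ
      split_ifs with h2 h3
      · exact le_rfl
      · obtain ⟨i, hi⟩ := h2
        exact absurd ⟨i, ENNReal.ofReal_le_ofReal (Real.exp_le_exp.2 (by gcongr))⟩ h3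
      · exact zero_le
      · exact le_rfl
    · rw [hprod, ← ENNReal.ofReal_mul (Real.exp_pos _).le, ← ENNReal.ofReal_mul (Real.exp_pos _).le,
        ← Real.exp_add, ← Real.exp_add]
      congr 2
      ring
  calc P {ω | ∃ i, f (ω (t 0)) + ε ≤ f (ω (t i))}
      ≤ P (⋃ σ ∈ (Finset.univ.filter fun σ : Fin (n + 1) → Config N =>
          ∃ i, f (σ 0) + ε ≤ f (σ i)), {ω | ∀ i, ω (t i) = σ i}) := by
        refine measure_mono fun ω hω => mem_iUnion₂.2 ⟨fun i => ω (t i), ?_, fun i => rfl⟩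
        simpa using hω
    _ ≤ ∑ σ ∈ (Finset.univ.filter fun σ : Fin (n + 1) → Config N =>
          ∃ i, f (σ 0) + ε ≤ f (σ i)), P {ω | ∀ i, ω (t i) = σ i} :=
        measure_biUnion_finset_le _ _
    _ = ∑ η, P {ω | ω (t 0) = η} * (∑ τ : Fin n → Config N,
          if ∃ i, f η + ε ≤ f ((Fin.cons η τ : Fin (n + 1) → Config N) i) then
            pathWeight q (Fin.cons η τ : Fin (n + 1) → Config N) else 0) := by
        rw [Finset.sum_filter, sum_fin_succ_pi]
        refine Finset.sum_congr rfl fun η _ => ?_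
        rw [Finset.mul_sum]
        refine Finset.sum_congr rfl fun τ _ => ?_
        rw [mul_ite, mul_zero, hP.measure_forall_eq ht]
        simp [q]
    _ ≤ ∑ η, P {ω | ω (t 0) = η} *
          ENNReal.ofReal (Real.exp (B * (t (Fin.last n) - t 0) - θ * ε)) := by
        gcongr with η
        exact hbad η
    _ = ENNReal.ofReal (Real.exp (B * (t (Fin.last n) - t 0) - θ * ε)) := by
        have h1 := sum_measure_preimage_singleton (μ := P) (Finset.univ : Finset (Config N))
          (f := fun ω : CadlagPath ℝ≥0 (Config N) => ω (t 0))
          fun σ _ => measurable_eval (t 0) (measurableSet_singleton σ)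
        rw [Finset.coe_univ, preimage_univ, measure_univ] at h1
        rw [← Finset.sum_mul]
        erw [h1]
        rw [one_mul]

/-- Continuity from below along the increasing sets `⋂ j ≥ m, V j`; no measurability is needed. -/
theorem measure_le_of_eventually_subset {Ω : Type*} [MeasurableSpace Ω] {P : Measure Ω}
    {U : Set Ω} {V : ℕ → Set Ω} {c : ℝ≥0∞} (hU : ∀ ω ∈ U, ∀ᶠ m in atTop, ω ∈ V m)
    (hV : ∀ m, P (V m) ≤ c) : P U ≤ c := by
  have hmono : Monotone fun m => ⋂ j ≥ m, V j := fun m m' hm =>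
    biInter_subset_biInter_left fun j hj => le_trans hm hj
  calc P U ≤ P (⋃ m, ⋂ j ≥ m, V j) := by
        refine measure_mono fun ω hω => ?_
        obtain ⟨m, hm⟩ := eventually_atTop.1 (hU ω hω)
        exact mem_iUnion.2 ⟨m, mem_iInter₂.2 hm⟩
    _ = ⨆ m, P (⋂ j ≥ m, V j) := hmono.measure_iUnion
    _ ≤ c := iSup_le fun m => (measure_mono (biInter_subset_of_mem (le_refl m))).trans (hV m)

/-- The state space is discrete, so a path keeps its value for a while after `t`, and every
sufficiently fine grid contains a point that sees this value. -/
theorem IsExclusionLaw.measure_exists_le (hP : IsExclusionLaw b β N μ P)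
    [IsProbabilityMeasure μ] {f : Config N → ℝ} {θ B : ℝ} (hθ : 0 ≤ θ) (hB0 : 0 ≤ B)
    (hB : ∀ η, ((N : ℕ) : ℝ) ^ 2 * generator b β N (fun ζ => Real.exp (θ * f ζ)) η ≤
      B * Real.exp (θ * f η)) (s : ℝ≥0) {r : ℝ≥0} (hr : 0 < r) (ε : ℝ) :
    P {ω | ∃ t, s ≤ t ∧ t < s + r ∧ f (ω s) + ε ≤ f (ω t)} ≤
      ENNReal.ofReal (Real.exp (B * r - θ * ε)) := by
  let g : (m : ℕ) → Fin (m + 1 + 1) → ℝ≥0 := fun m i => s + (i : ℕ) * (r / (m + 1 : ℕ))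
  have hg : ∀ m, Monotone (g m) := fun m i j hij => by
    simp only [g]
    gcongr
    exact hij
  have hg0 : ∀ m, g m 0 = s := fun m => by simp [g]
  have hgl : ∀ m, ((g m (Fin.last (m + 1)) : ℝ≥0) : ℝ) - g m 0 = r := fun m => by
    have hm : ((m : ℝ) + 1) ≠ 0 := by positivity
    rw [hg0]
    simp only [g]
    push_cast [Fin.val_last]
    field_simp
    ring
  refine measure_le_of_eventually_subset
    (V := fun m => {ω | ∃ i, f (ω (g m 0)) + ε ≤ f (ω (g m i))}) ?_ fun m => ?_
  · rintro ω ⟨t, hst, htr, hf⟩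
    have h1 : ∀ᶠ u in 𝓝[≥] t, ω u = ω t := 
      
      (ω.isCadlag t).1.eventually (mem_nhds_discrete (s := {x | x = ω t}).2 rfl)
    obtain ⟨κ, hκ, hκ'⟩ := Metric.eventually_nhds_iff.1 (eventually_nhdsWithin_iff.1 h1)
    have h2 : ∀ᶠ m : ℕ in atTop, (r : ℝ) / (m + 1 : ℕ) < κ :=
      ((tendsto_const_div_atTop_nhds_zero_nat (r : ℝ)).comp (tendsto_add_atTop_nat 1)).eventually
        (gt_mem_nhds hκ)
    filter_upwards [h2] with m hm
    have hm0 : (0 : ℝ) < (m + 1 : ℕ) := by positivity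
    have hr' : (0 : ℝ) < r := hr
    have hst' : (s : ℝ) ≤ t := hst
    have htr' : (t : ℝ) < s + r := by exact_mod_cast htr
    set y : ℝ := ((t : ℝ) - s) / (r / (m + 1 : ℕ)) with hy
    have hd : (0 : ℝ) < r / (m + 1 : ℕ) := by positivity
    have hy0 : 0 ≤ y := div_nonneg (sub_nonneg.2 hst') hd.le
    have hys : y * (r / (m + 1 : ℕ)) = t - s := div_mul_cancel₀ _ hd.ne'
    have hle : ⌈y⌉₊ ≤ m + 1 := by
      refine Nat.ceil_le.2 ?_
      rw [hy, div_le_iff₀ hd, mul_div_cancel₀ _ hm0.ne']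
      linarith
    let i : Fin (m + 1 + 1) := ⟨⌈y⌉₊, Nat.lt_succ_of_le hle⟩
    have hgi : ((g m i : ℝ≥0) : ℝ) = s + ⌈y⌉₊ * (r / (m + 1 : ℕ)) := by simp [g, i]
    have h3 : (t : ℝ) ≤ g m i := by
      rw [hgi]
      have := mul_le_mul_of_nonneg_right (Nat.le_ceil y) hd.le
      linarith
    have h4 : (g m i : ℝ) < t + κ := by
      rw [hgi]
      have := mul_lt_mul_of_pos_right (Nat.ceil_lt_add_one hy0) hd
      linarith
    refine ⟨i, ?_⟩
    rw [hg0, hκ' (y := g m i) ?_ (NNReal.coe_le_coe.1 h3)]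
    · exact hf
    · rw [NNReal.dist_eq, abs_of_nonneg (sub_nonneg.2 h3)]
      linarith
  · have h5 := hP.measure_exists_grid_le hθ hB0 hB (hg m) ε
    rwa [hgl] at h5

end Law

/-! ### Test functions with bounded second differences -/

/-- First differences of `H` are at most `C |h|`, and second differences at most `C h²`. -/
structure HasDifferenceBound {E : Type*} [NormedAddCommGroup E] (H : UnitAddCircle → E) (C : ℝ) :
    Prop where
  first : ∀ u (h : ℝ), ‖H (u + (h : UnitAddCircle)) - H u‖ ≤ C * |h|
  second : ∀ u (h : ℝ),
    ‖H (u + (h : UnitAddCircle)) + H (u - (h : UnitAddCircle)) - 2 • H u‖ ≤ C * h ^ 2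

namespace HasDifferenceBound

variable {E : Type*} [NormedAddCommGroup E] {H G : UnitAddCircle → E} {C C' : ℝ}

theorem nonneg (hH : HasDifferenceBound H C) : 0 ≤ C := by
  simpa using (norm_nonneg _).trans (hH.first 0 1)

theorem add (hH : HasDifferenceBound H C) (hG : HasDifferenceBound G C') :
    HasDifferenceBound (H + G) (C + C') where
  first u h := by
    rw [add_mul]
    refine le_trans (le_of_eq ?_) ((norm_add_le _ _).trans (add_le_add (hH.first u h) (hG.first u h)))
    congr 1
    simp only [Pi.add_apply]
    abel
  second u h := by
    rw [add_mul]
    refine le_trans (le_of_eq ?_)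
      ((norm_add_le _ _).trans (add_le_add (hH.second u h) (hG.second u h)))
    congr 1
    simp only [Pi.add_apply, smul_add]
    abel

theorem smul {𝕜 : Type*} [NormedField 𝕜] [NormedSpace 𝕜 E] (hH : HasDifferenceBound H C) (c : 𝕜) :
    HasDifferenceBound (c • H) (‖c‖ * C) where
  first u h := by
    simp only [Pi.smul_apply]
    rw [← smul_sub, norm_smul, mul_assoc]
    exact mul_le_mul_of_nonneg_left (hH.first u h) (norm_nonneg _)
  second u h := by
    simp only [Pi.smul_apply]
    rw [smul_comm, ← smul_add, ← smul_sub, norm_smul, mul_assoc]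
    exact mul_le_mul_of_nonneg_left (hH.second u h) (norm_nonneg _)

theorem neg (hH : HasDifferenceBound H C) : HasDifferenceBound (-H) C where
  first u h := by
    simp only [Pi.neg_apply]
    rw [← neg_sub', norm_neg]
    exact hH.first u h
  second u h := by
    simp only [Pi.neg_apply]
    rw [smul_neg, ← neg_add, ← neg_sub', norm_neg]
    exact hH.second u h

end HasDifferenceBound

/-! ### The drift of the empirical measure -/

section Drift

variable {k : ℕ} {b : Fin k → UnitAddCircle} {β : ℝ} {N : ℕ+}

theorem integrals_empiricalMeasure (η : Config N) (H : C(UnitAddCircle, ℝ)) :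
    (empiricalMeasure η).integrals H =
      ((N : ℕ) : ℝ)⁻¹ * ∑ x : ZMod (N : ℕ), (if η x then 1 else 0) * H (ZMod.toAddCircle x) := by
  change ∫ u, H u ∂(empiricalMeasureAux η) = _
  have hint : ∀ x : ZMod (N : ℕ), Integrable (fun u => H u) ((if η x then 1 else 0 : ℝ≥0∞) •
      Measure.dirac (((x.val : ℝ) / (N : ℕ) : ℝ) : UnitAddCircle)) := fun x =>
    (integrable_dirac (by simp)).smul_measure (by split_ifs <;> simp)
  rw [empiricalMeasureAux, integral_smul_measure, integral_finsetSum_measure fun x _ => hint x]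
  simp only [integral_smul_measure, integral_dirac, ZMod.toAddCircle_apply, smul_eq_mul,
    ENNReal.toReal_inv, ENNReal.toReal_natCast]
  congr 1
  exact Finset.sum_congr rfl fun x _ => by split_ifs <;> simp

theorem sum_exchange_sub (η : Config N) (x : ZMod (N : ℕ)) (h : ZMod (N : ℕ) → ℝ) :
    ∑ y, (if exchange η x y then 1 else 0) * h y - ∑ y, (if η y then 1 else 0) * h y =
      ((if η x then 1 else 0) - (if η (x + 1) then 1 else 0)) * (h (x + 1) - h x) := by
  have h1 : ∑ y, (if exchange η x y then 1 else 0) * h y =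
      ∑ y, (if η y then 1 else 0) * h (Equiv.swap x (x + 1) y) := by
    rw [← Equiv.sum_comp (Equiv.swap x (x + 1))]
    simp [exchange]
  rw [h1, ← Finset.sum_sub_distrib]
  -- When `N = 1` the two sites coincide and both sides vanish.
  by_cases hx : x = x + 1
  · rw [← hx]
    simp
  · rw [Fintype.sum_eq_add x (x + 1) hx]
    · rw [Equiv.swap_apply_left, Equiv.swap_apply_right]
      ring
    · rintro y ⟨h2, h3⟩
      rw [Equiv.swap_apply_of_ne_of_ne h2 h3, sub_self]

theorem integrals_exchange_sub (η : Config N) (x : ZMod (N : ℕ)) (H : C(UnitAddCircle, ℝ)) :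
    (empiricalMeasure (exchange η x)).integrals H - (empiricalMeasure η).integrals H =
      ((N : ℕ) : ℝ)⁻¹ * (((if η x then 1 else 0) - (if η (x + 1) then 1 else 0)) *
        (H (ZMod.toAddCircle (x + 1)) - H (ZMod.toAddCircle x))) := by
  rw [integrals_empiricalMeasure, integrals_empiricalMeasure, ← mul_sub]
  congr 1
  exact sum_exchange_sub η x fun y => H (ZMod.toAddCircle y)

theorem conductance_le_one (hβ : 0 ≤ β) (x : ZMod (N : ℕ)) : conductance b β N x ≤ 1 := by
  unfold conductance
  split_ifs
  · exact Real.rpow_le_one_of_one_le_of_nonpos (by exact_mod_cast (one_le : 1 ≤ N)) (by linarith)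
  · exact le_rfl

open scoped Classical in
-- The intervals `(x/N, (x+1)/N]` are disjoint subsets of `(0, 1]`, on which the projection to the
-- torus is injective, so each `b i` slows down at most one bond.
theorem card_conductance_ne_one_le :
    (Finset.univ.filter fun x : ZMod (N : ℕ) => conductance b β N x ≠ 1).card ≤ k := by
  have hN : (0 : ℝ) < (N : ℕ) := Nat.cast_pos.2 N.pos
  have hex : ∀ x : ZMod (N : ℕ), conductance b β N x ≠ 1 →
      ∃ i, ∃ u : ℝ, u ∈ Ioc ((x.val : ℝ) / (N : ℕ)) (((x.val : ℝ) + 1) / (N : ℕ)) ∧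
        (u : UnitAddCircle) = b i := by
    intro x hx
    unfold conductance at hx
    split_ifs at hx with h
    · exact h
    · exact absurd rfl hx
  rcases isEmpty_or_nonempty (Fin k) with hk | hk
  · rw [Finset.card_eq_zero.2]
    · exact Nat.zero_le _
    · refine Finset.filter_eq_empty_iff.2 fun x _ hx => ?_
      exact hk.elim (hex x hx).choose
  choose! i u hu hi using hex
  have hcard := Finset.card_le_card_of_injOn
    (s := Finset.univ.filter fun x : ZMod (N : ℕ) => conductance b β N x ≠ 1)
    (t := (Finset.univ : Finset (Fin k))) i (fun _ _ => Finset.mem_coe.2 (Finset.mem_univ _)) ?_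
  · simpa using hcard
  intro x hx y hy hxy
  simp only [Finset.coe_filter, Finset.mem_univ, true_and, mem_ofPred_eq] at hx hy
  have hcirc : (u x : UnitAddCircle) = u y := by rw [hi x hx, hi y hy, hxy]
  have hx1 := (hu x hx).1
  have hx2 := (hu x hx).2
  have hy1 := (hu y hy).1
  have hy2 := (hu y hy).2
  rw [div_lt_iff₀ hN] at hx1 hy1
  rw [le_div_iff₀ hN] at hx2 hy2
  have hxN : (x.val : ℝ) + 1 ≤ (N : ℕ) := by exact_mod_cast ZMod.val_lt x
  have hyN : (y.val : ℝ) + 1 ≤ (N : ℕ) := by exact_mod_cast ZMod.val_lt y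
  have hx0 : 0 < u x := by
    by_contra! h
    nlinarith [Nat.cast_nonneg (α := ℝ) x.val]
  have hy0 : 0 < u y := by
    by_contra! h
    nlinarith [Nat.cast_nonneg (α := ℝ) y.val]
  have hx1' : u x ≤ 1 := by
    by_contra! h
    nlinarith
  have hy1' : u y ≤ 1 := by
    by_contra! h
    nlinarith
  have huv : u x = u y := by
    have hmem : ∀ v : ℝ, 0 < v → v ≤ 1 → v ∈ Ioc (0 : ℝ) (0 + 1) := fun v h1 h2 =>
      ⟨h1, by rwa [zero_add]⟩
    exact (AddCircle.coe_eq_coe_iff_of_mem_Ioc (hmem _ hx0 hx1') (hmem _ hy0 hy1')).1 hcirc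
  rw [huv] at hx1 hx2
  have h1 : (x.val : ℝ) < y.val + 1 := by linarith
  have h2 : (y.val : ℝ) < x.val + 1 := by linarith
  have h3 : x.val < y.val + 1 := by exact_mod_cast h1
  have h4 : y.val < x.val + 1 := by exact_mod_cast h2
  exact ZMod.val_injective _ (by omega)

theorem toAddCircle_one : ZMod.toAddCircle (1 : ZMod (N : ℕ)) =
    (((N : ℕ) : ℝ)⁻¹ : ℝ) := by
  have := ZMod.toAddCircle_intCast (N := (N : ℕ)) 1
  simpa using this

/-- With unit conductances, summation by parts leaves `N` second differences of size `C / N²`. The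
correction `1 - ξ` lives on at most `k` bonds, each contributing at most a first difference `C / N`.
-/
theorem abs_sum_conductance_mul_le (hβ : 0 ≤ β) {H : UnitAddCircle → ℝ} {C : ℝ}
    (hH : HasDifferenceBound H C) (η : Config N) :
    |∑ x : ZMod (N : ℕ), conductance b β N x *
      (((if η x then 1 else 0) - (if η (x + 1) then 1 else 0)) *
        (H (ZMod.toAddCircle (x + 1)) - H (ZMod.toAddCircle x)))| ≤ (k + 1) * C / (N : ℕ) := by
  classical
  have hN : (0 : ℝ) < (N : ℕ) := Nat.cast_pos.2 N.pos
  let e : ZMod (N : ℕ) → ℝ := fun x => if η x then 1 else 0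
  let D : ZMod (N : ℕ) → ℝ := fun x => H (ZMod.toAddCircle (x + 1)) - H (ZMod.toAddCircle x)
  have he0 : ∀ x, 0 ≤ e x := fun x => by simp only [e]; split_ifs <;> simp
  have he1 : ∀ x, e x ≤ 1 := fun x => by simp only [e]; split_ifs <;> simp
  have hD : ∀ x, |D x| ≤ C / (N : ℕ) := fun x => by
    have := hH.first (ZMod.toAddCircle x) ((N : ℕ) : ℝ)⁻¹
    rw [← toAddCircle_one, ← map_add, abs_of_pos (inv_pos.2 hN), ← div_eq_mul_inv] at this
    exact this
  have hD2 : ∀ x, |D x - D (x - 1)| ≤ C / ((N : ℕ) : ℝ) ^ 2 := fun x => by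
    have := hH.second (ZMod.toAddCircle x) ((N : ℕ) : ℝ)⁻¹
    rw [← toAddCircle_one, ← map_add, ← map_sub, inv_pow, ← div_eq_mul_inv] at this
    refine le_trans (le_of_eq ?_) this
    rw [Real.norm_eq_abs]
    congr 1
    simp only [D, sub_add_cancel, two_smul]
    ring
  have hsplit : ∑ x, conductance b β N x * ((e x - e (x + 1)) * D x) =
      ∑ x, e x * (D x - D (x - 1)) -
        ∑ x, (1 - conductance b β N x) * ((e x - e (x + 1)) * D x) := by
    have h1 : ∑ x, e (x + 1) * D x = ∑ x, e x * D (x - 1) := by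
      rw [← Equiv.sum_comp (Equiv.addRight (1 : ZMod (N : ℕ))) fun x => e x * D (x - 1)]
      simp
    simp only [mul_sub, sub_mul, one_mul, Finset.sum_sub_distrib, h1]
    ring
  have hfast : |∑ x, e x * (D x - D (x - 1))| ≤ C / (N : ℕ) := by
    calc |∑ x, e x * (D x - D (x - 1))| ≤ ∑ x : ZMod (N : ℕ), C / ((N : ℕ) : ℝ) ^ 2 := by
          refine (Finset.abs_sum_le_sum_abs _ _).trans (Finset.sum_le_sum fun x _ => ?_)
          rw [abs_mul, abs_of_nonneg (he0 x)]
          exact (mul_le_of_le_one_left (abs_nonneg _) (he1 x)).trans (hD2 x)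
      _ = C / (N : ℕ) := by
          rw [Finset.sum_const, Finset.card_univ, ZMod.card, nsmul_eq_mul]
          field_simp
  have hslow : |∑ x, (1 - conductance b β N x) * ((e x - e (x + 1)) * D x)| ≤
      k * (C / (N : ℕ)) := by
    have h0 : ∀ x ∈ Finset.univ, x ∉ (Finset.univ.filter fun x : ZMod (N : ℕ) =>
        conductance b β N x ≠ 1) → (1 - conductance b β N x) * ((e x - e (x + 1)) * D x) = 0 := by
      intro x _ hx
      have hx1 : conductance b β N x = 1 := by simpa using hx
      rw [hx1, sub_self, zero_mul]
    rw [← Finset.sum_subset (Finset.filter_subset _ _) h0]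
    refine (Finset.abs_sum_le_sum_abs _ _).trans ((Finset.sum_le_card_nsmul _ _ (C / (N : ℕ))
      fun x _ => ?_).trans ?_)
    · rw [abs_mul, abs_mul]
      have h1 : |1 - conductance b β N x| ≤ 1 := abs_le.2
        ⟨by linarith [conductance_le_one (b := b) hβ x],
          by linarith [conductance_nonneg (b := b) (β := β) x]⟩
      have h2 : |e x - e (x + 1)| ≤ 1 := abs_le.2
        ⟨by linarith [he0 x, he1 (x + 1)], by linarith [he1 x, he0 (x + 1)]⟩
      exact (mul_le_of_le_one_left (by positivity) h1).trans
        ((mul_le_of_le_one_left (abs_nonneg _) h2).trans (hD x))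
    · rw [nsmul_eq_mul]
      exact mul_le_mul_of_nonneg_right (by exact_mod_cast card_conductance_ne_one_le)
        (div_nonneg hH.nonneg hN.le)
  change |∑ x, conductance b β N x * ((e x - e (x + 1)) * D x)| ≤ _
  rw [hsplit]
  refine (abs_sub _ _).trans ((add_le_add hfast hslow).trans (le_of_eq ?_))
  ring

/-- For `|u| ≤ 1` one has `e^u - 1 ≤ u + u²`; here `u`, the change of the exponent under one
exchange, is at most `θC/N²`. The linear terms give the drift, and the quadratic ones at most `N² ·
N · (θC/N²)² = θ²C²/N`. -/
theorem generator_exp_le (hβ : 0 ≤ β) {H : C(UnitAddCircle, ℝ)} {C : ℝ}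
    (hH : HasDifferenceBound H C) {θ : ℝ} (hθ : 0 ≤ θ) (hθN : θ * C ≤ (N : ℕ)) (η : Config N) :
    ((N : ℕ) : ℝ) ^ 2 *
        generator b β N (fun ζ => Real.exp (θ * (empiricalMeasure ζ).integrals H)) η ≤
      (θ * ((k + 1) * C) + θ ^ 2 * C ^ 2 / (N : ℕ)) *
        Real.exp (θ * (empiricalMeasure η).integrals H) := by
  have hN : (0 : ℝ) < (N : ℕ) := Nat.cast_pos.2 N.pos
  have hN1 : (1 : ℝ) ≤ (N : ℕ) := by exact_mod_cast (one_le : 1 ≤ N)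
  have hC := hH.nonneg
  let f : Config N → ℝ := fun ζ => (empiricalMeasure ζ).integrals H
  let A : ZMod (N : ℕ) → ℝ := fun x =>
    ((if η x then 1 else 0) - (if η (x + 1) then 1 else 0)) *
      (H (ZMod.toAddCircle (x + 1)) - H (ZMod.toAddCircle x))
  have hf : ∀ x, f (exchange η x) - f η = ((N : ℕ) : ℝ)⁻¹ * A x := fun x =>
    integrals_exchange_sub η x H
  have hA : ∀ x, |A x| ≤ C / (N : ℕ) := fun x => by
    have h1 := hH.first (ZMod.toAddCircle x) ((N : ℕ) : ℝ)⁻¹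
    rw [← toAddCircle_one, ← map_add, abs_of_pos (inv_pos.2 hN), ← div_eq_mul_inv] at h1
    simp only [A]
    rw [abs_mul]
    refine (mul_le_of_le_one_left (abs_nonneg _) ?_).trans h1
    split_ifs <;> simp
  have hu : ∀ x, |θ * (((N : ℕ) : ℝ)⁻¹ * A x)| ≤ θ * C / ((N : ℕ) : ℝ) ^ 2 := fun x => by
    rw [abs_mul, abs_mul, abs_of_nonneg hθ, abs_of_pos (inv_pos.2 hN)]
    calc θ * (((N : ℕ) : ℝ)⁻¹ * |A x|) ≤ θ * (((N : ℕ) : ℝ)⁻¹ * (C / (N : ℕ))) := by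
          gcongr
          exact hA x
      _ = θ * C / ((N : ℕ) : ℝ) ^ 2 := by
          field_simp
  have hu1 : θ * C / ((N : ℕ) : ℝ) ^ 2 ≤ 1 := by
    rw [div_le_one (by positivity)]
    nlinarith
  have hterm : ∀ x, conductance b β N x * (Real.exp (θ * f (exchange η x)) - Real.exp (θ * f η)) ≤
      (θ * ((N : ℕ) : ℝ)⁻¹ * (conductance b β N x * A x) + (θ * C / ((N : ℕ) : ℝ) ^ 2) ^ 2) *
        Real.exp (θ * f η) := by
    intro x
    have h1 : Real.exp (θ * f (exchange η x)) =
        Real.exp (θ * (((N : ℕ) : ℝ)⁻¹ * A x)) * Real.exp (θ * f η) := by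
      rw [← Real.exp_add, ← hf]
      congr 1
      ring
    rw [h1, ← sub_one_mul, ← mul_assoc]
    refine mul_le_mul_of_nonneg_right ?_ (Real.exp_pos _).le
    have h2 := (abs_le.1 (Real.abs_exp_sub_one_sub_id_le ((hu x).trans hu1))).2
    have h3 : (θ * (((N : ℕ) : ℝ)⁻¹ * A x)) ^ 2 ≤ (θ * C / ((N : ℕ) : ℝ) ^ 2) ^ 2 := by
      rw [← sq_abs]
      exact pow_le_pow_left₀ (abs_nonneg _) (hu x) 2
    have h4 := conductance_nonneg (b := b) (β := β) x
    have h5 := conductance_le_one (b := b) hβ x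
    calc conductance b β N x * (Real.exp (θ * (((N : ℕ) : ℝ)⁻¹ * A x)) - 1)
        ≤ conductance b β N x * (θ * (((N : ℕ) : ℝ)⁻¹ * A x) +
            (θ * C / ((N : ℕ) : ℝ) ^ 2) ^ 2) := by
          gcongr
          linarith
      _ ≤ conductance b β N x * (θ * (((N : ℕ) : ℝ)⁻¹ * A x)) +
            (θ * C / ((N : ℕ) : ℝ) ^ 2) ^ 2 := by
          rw [mul_add]
          gcongr
          exact mul_le_of_le_one_left (sq_nonneg _) h5
      _ = θ * ((N : ℕ) : ℝ)⁻¹ * (conductance b β N x * A x) +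
            (θ * C / ((N : ℕ) : ℝ) ^ 2) ^ 2 := by ring
  have hdrift : ∑ x, conductance b β N x * A x ≤ (k + 1) * C / (N : ℕ) :=
    (le_abs_self _).trans (abs_sum_conductance_mul_le hβ hH η)
  rw [generator_apply]
  calc ((N : ℕ) : ℝ) ^ 2 * ∑ x : ZMod (N : ℕ), conductance b β N x *
        (Real.exp (θ * f (exchange η x)) - Real.exp (θ * f η))
      ≤ ((N : ℕ) : ℝ) ^ 2 * ∑ x : ZMod (N : ℕ), (θ * ((N : ℕ) : ℝ)⁻¹ * (conductance b β N x * A x)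
          + (θ * C / ((N : ℕ) : ℝ) ^ 2) ^ 2) * Real.exp (θ * f η) := by
        exact mul_le_mul_of_nonneg_left (Finset.sum_le_sum fun x _ => hterm x) (by positivity)
    _ = (θ * (N : ℕ) * ∑ x, conductance b β N x * A x + θ ^ 2 * C ^ 2 / (N : ℕ)) *
          Real.exp (θ * f η) := by
        rw [← Finset.sum_mul, Finset.sum_add_distrib, ← Finset.mul_sum, Finset.sum_const,
          Finset.card_univ, ZMod.card, nsmul_eq_mul]
        field_simp
    _ ≤ (θ * (N : ℕ) * ((k + 1) * C / (N : ℕ)) + θ ^ 2 * C ^ 2 / (N : ℕ)) *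
          Real.exp (θ * f η) := by gcongr
    _ = (θ * ((k + 1) * C) + θ ^ 2 * C ^ 2 / (N : ℕ)) * Real.exp (θ * f η) := by
        congr 2
        field_simp

end Drift

/-! ### Density of the test functions -/

section Density

/-- Translation by `h` multiplies a character by `e^{iah}`, so the differences reduce to `|e^{iah} -
1| ≤ |ah|` and `0 ≤ 2(1 - cos(ah)) ≤ (ah)²`. -/
theorem hasDifferenceBound_fourier (n : ℤ) :
    ∃ C, HasDifferenceBound (fourier n : C(UnitAddCircle, ℂ)) C := by
  let a : ℝ := 2 * Real.pi * n
  have hadd : ∀ (u : UnitAddCircle) (h : ℝ), (fourier n (u + (h : UnitAddCircle)) : ℂ) =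
      fourier n u * Complex.exp ((a * h : ℝ) * Complex.I) := by
    intro u h
    rw [fourier_apply, smul_add, AddCircle.toCircle_add, Circle.coe_mul, ← fourier_apply,
      ← fourier_apply, fourier_coe_apply]
    congr 2
    simp only [a]
    push_cast
    ring
  have hnorm : ∀ u : UnitAddCircle, ‖(fourier n u : ℂ)‖ = 1 := fun u => by
    rw [fourier_apply, Circle.norm_coe]
  refine ⟨max |a| (a ^ 2), fun u h => ?_, fun u h => ?_⟩
  · rw [hadd, ← mul_sub_one, norm_mul, hnorm, one_mul]
    have h1 := Real.norm_exp_I_mul_ofReal_sub_one_le (x := a * h)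
    rw [mul_comm] at h1
    refine h1.trans ?_
    rw [Real.norm_eq_abs, abs_mul]
    gcongr
    exact le_max_left _ _
  · have h1 : (fourier n (u - (h : UnitAddCircle)) : ℂ) =
        fourier n u * Complex.exp ((a * -h : ℝ) * Complex.I) := by
      rw [← hadd, sub_eq_add_neg]
      congr 2
    rw [hadd, h1]
    have h2 : (fourier n u : ℂ) * Complex.exp ((a * h : ℝ) * Complex.I) +
        fourier n u * Complex.exp ((a * -h : ℝ) * Complex.I) - 2 • fourier n u =
        fourier n u * ((2 * (Real.cos (a * h) - 1) : ℝ) : ℂ) := by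
      rw [Complex.exp_mul_I, Complex.exp_mul_I, mul_neg, Complex.ofReal_neg, Complex.cos_neg,
        Complex.sin_neg]
      push_cast
      rw [two_smul]
      ring
    rw [h2, norm_mul, hnorm, one_mul, Complex.norm_real, Real.norm_eq_abs]
    have h3 := Real.one_sub_sq_div_two_le_cos (x := a * h)
    have h4 := Real.cos_le_one (a * h)
    have h5 : a ^ 2 * h ^ 2 ≤ max |a| (a ^ 2) * h ^ 2 := by
      gcongr
      exact le_max_right _ _
    rw [abs_of_nonpos (by linarith)]
    nlinarith

theorem exists_hasDifferenceBound_of_mem_span {F : C(UnitAddCircle, ℂ)}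
    (hF : F ∈ Submodule.span ℂ (range (fourier : ℤ → C(UnitAddCircle, ℂ)))) :
    ∃ C, HasDifferenceBound F C := by
  induction hF using Submodule.span_induction with
  | mem F hF =>
    obtain ⟨n, rfl⟩ := hF
    exact hasDifferenceBound_fourier n
  | zero => exact ⟨0, fun u h => by simp, fun u h => by simp⟩
  | add F G _ _ hF hG =>
    obtain ⟨C, hC⟩ := hF
    obtain ⟨C', hC'⟩ := hG
    exact ⟨_, hC.add hC'⟩
  | smul c F _ hF =>
    obtain ⟨C, hC⟩ := hF
    exact ⟨_, hC.smul c⟩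

/-- Trigonometric polynomials are uniformly dense, and taking real parts does not increase distances
or differences. -/
theorem dense_hasDifferenceBound :
    Dense {G : C(UnitAddCircle, ℝ) | ∃ C, HasDifferenceBound G C} := by
  intro H
  refine Metric.mem_closure_iff.2 fun ε hε => ?_
  let H' : C(UnitAddCircle, ℂ) := (⟨_, Complex.continuous_ofReal⟩ : C(ℝ, ℂ)).comp H
  have hmem : H' ∈ closure
      (Submodule.span ℂ (range (fourier : ℤ → C(UnitAddCircle, ℂ))) : Set C(UnitAddCircle, ℂ)) := by
    rw [← Submodule.topologicalClosure_coe, span_fourier_closure_eq_top]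
    trivial
  obtain ⟨F, hF, hHF⟩ := Metric.mem_closure_iff.1 hmem ε hε
  obtain ⟨C, hC⟩ := exists_hasDifferenceBound_of_mem_span hF
  refine ⟨(⟨_, Complex.continuous_re⟩ : C(ℂ, ℝ)).comp F, ⟨C, fun u h => ?_, fun u h => ?_⟩, ?_⟩
  · refine le_trans ?_ (hC.first u h)
    have := Complex.abs_re_le_norm (F (u + (h : UnitAddCircle)) - F u)
    simpa using this
  · refine le_trans ?_ (hC.second u h)
    have := Complex.abs_re_le_norm
      (F (u + (h : UnitAddCircle)) + F (u - (h : UnitAddCircle)) - 2 • F u)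
    simpa using this
  · rw [ContinuousMap.dist_lt_iff hε] at hHF ⊢
    intro u
    refine lt_of_le_of_lt ?_ (hHF u)
    rw [Real.dist_eq, dist_eq_norm]
    have := Complex.abs_re_le_norm (H' u - F u)
    simpa [H'] using this

theorem exists_countable_dense_hasDifferenceBound :
    ∃ s : Set C(UnitAddCircle, ℝ), s.Countable ∧ Dense s ∧
      ∀ G ∈ s, ∃ C, HasDifferenceBound G C := by
  obtain ⟨s, hs, hsc, hsd⟩ := dense_hasDifferenceBound.exists_countable_dense_subset
  exact ⟨s, hsc, hsd, fun G hG => hs hG⟩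

end Density

/-! ### The space of measures -/

namespace SubProb

instance : CompactSpace SubProb := by
  have h : IsCompact {m : FiniteMeasure UnitAddCircle | m.mass ≤ 1} := by
    exact isCompact_setOfPred_finiteMeasure_le_of_compactSpace UnitAddCircle 1
  exact isCompact_iff_compactSpace.1 h

instance : T2Space SubProb :=
  inferInstanceAs (T2Space {m : FiniteMeasure UnitAddCircle // m.mass ≤ 1})

theorem continuous_integrals (H : C(UnitAddCircle, ℝ)) :
    Continuous fun m : SubProb => m.integrals H :=
  (continuous_apply H).comp isInducing_integrals.continuous

theorem uniformity_eq : 𝓤 SubProb =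
    comap (fun p : SubProb × SubProb => (p.1.integrals, p.2.integrals))
      (𝓤 (C(UnitAddCircle, ℝ) → ℝ)) := rfl

theorem abs_integrals_sub_le (m : SubProb) {H G : C(UnitAddCircle, ℝ)} {ε : ℝ}
    (h : dist H G ≤ ε) : |m.integrals H - m.integrals G| ≤ ε := by
  have hint : ∀ F : C(UnitAddCircle, ℝ), Integrable F (m.1 : Measure UnitAddCircle) := fun F =>
    F.continuous.integrable_of_hasCompactSupport (HasCompactSupport.of_compactSpace _)
  have hε : 0 ≤ ε := dist_nonneg.trans h
  have h1 : m.integrals H - m.integrals G = ∫ u, (H u - G u) ∂(m.1 : Measure UnitAddCircle) :=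
    (integral_sub (hint H) (hint G)).symm
  have hm : (m.1 : Measure UnitAddCircle).real univ ≤ 1 := by
    have : ((m.1.mass : ℝ≥0) : ℝ) ≤ 1 := m.2
    exact this
  rw [h1, ← Real.norm_eq_abs]
  calc ‖∫ u, (H u - G u) ∂(m.1 : Measure UnitAddCircle)‖
      ≤ ε * (m.1 : Measure UnitAddCircle).real univ :=
        norm_integral_le_of_norm_le_const (Eventually.of_forall fun u => by
          rw [← dist_eq_norm]
          exact (ContinuousMap.dist_apply_le_dist u).trans h)
    _ ≤ ε := mul_le_of_le_one_right hε hm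

/-- Pairs of measures whose integrals of `G` differ by at most `c`. -/
def closePairs (G : C(UnitAddCircle, ℝ)) (c : ℝ) : Set (SubProb × SubProb) :=
  {p | |p.1.integrals G - p.2.integrals G| ≤ c}

theorem isClosed_closePairs (G : C(UnitAddCircle, ℝ)) (c : ℝ) : IsClosed (closePairs G c) :=
  isClosed_le (((continuous_integrals G).comp continuous_fst).sub
    ((continuous_integrals G).comp continuous_snd)).abs continuous_const

/-- Since masses are at most one, integrals are 1-Lipschitz in the test function, so a dense family
determines the uniformity; the error is three times `ε / 4`. -/
theorem iInf_closePairs_le_uniformity {s : Set C(UnitAddCircle, ℝ)} (hs : Dense s) :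
    ⨅ p : s × ℕ, 𝓟 (closePairs p.1 (1 / (p.2 + 1))) ≤ 𝓤 SubProb := by
  rw [uniformity_eq, ← map_le_iff_le_comap, Pi.uniformity]
  refine le_iInf fun H => ?_
  rw [← map_le_iff_le_comap, map_map]
  refine Metric.uniformity_basis_dist.ge_iff.2 fun ε hε => ?_
  obtain ⟨G, hG, hHG⟩ := Metric.mem_closure_iff.1 (hs H) (ε / 4) (by positivity)
  obtain ⟨n, hn⟩ := exists_nat_one_div_lt (show 0 < ε / 4 by positivity)
  refine mem_map.2 (mem_iInf_of_mem (⟨G, hG⟩, n) ?_)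
  rintro ⟨m, m'⟩ hm
  have h0 : |m.integrals G - m'.integrals G| ≤ 1 / ((n : ℝ) + 1) := hm
  have h1 := abs_integrals_sub_le m hHG.le
  have h2 := abs_integrals_sub_le m' hHG.le
  change |m.integrals H - m'.integrals H| < ε
  have h3 := abs_le.1 h0
  have h4 := abs_le.1 h1
  have h5 := abs_le.1 h2
  exact abs_lt.2 ⟨by linarith, by linarith⟩

theorem integrals_neg (m : SubProb) (H : C(UnitAddCircle, ℝ)) :
    m.integrals (-H) = -m.integrals H :=
  integral_neg _

end SubProb

/-! ### Measurable sets of paths -/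

section MeasurableSets

variable {T : ℝ}

theorem exists_countable_isRightDense (T : ℝ) :
    ∃ D : Set (Icc (0 : ℝ) T), D.Countable ∧ IsRightDense D := by
  obtain ⟨s, hsc, hsd⟩ := TopologicalSpace.exists_countable_dense (Icc (0 : ℝ) T)
  -- The endpoint has to be added, since its right neighbourhoods in `[0, T]` may reduce to the
  -- point itself.
  refine ⟨s ∪ {t | (t : ℝ) = T}, hsc.union (Subsingleton.countable fun a ha b hb =>
    Subtype.ext (ha.trans hb.symm)), fun t => frequently_iff.2 fun {U} hU => ?_⟩
  rcases t.2.2.eq_or_lt with h | h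
  · exact ⟨t, mem_of_mem_nhdsWithin (mem_Ici.2 le_rfl) hU, Or.inr h⟩
  · obtain ⟨w, hw, hwU⟩ := (mem_nhdsGE_iff_exists_Ico_subset'
      (show t < ⟨T, t.2.1.trans t.2.2, le_rfl⟩ from h)).1 hU
    obtain ⟨d, hd1, hd2⟩ := hsd.exists_mem_open isOpen_Ioo (nonempty_Ioo.2 hw)
    exact ⟨d, hwU ⟨hd2.1.le, hd2.2⟩, Or.inl hd1⟩

/-- The version of `modulusSet` in which only times in `D` are taken into account. -/
def modulusSetOn {E : Type*} [TopologicalSpace E] (D : Set (Icc (0 : ℝ) T)) (V : Set (E × E))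
    (δ : ℝ) : Set (CadlagPath (Icc (0 : ℝ) T) E) :=
  {x | ∀ u ∈ D, ∀ v ∈ D, dist u v < δ → (x u, x v) ∈ V}

theorem modulusSetOn_subset {E : Type*} [UniformSpace E] {D : Set (Icc (0 : ℝ) T)}
    (hD : IsRightDense D) {V : Set (E × E)} (hV : IsClosed V) (δ : ℝ) :
    modulusSetOn D V δ ⊆ modulusSet T V δ := by
  intro x hx u v huv
  by_contra hnot
  have h1 : ∀ᶠ p in 𝓝[≥] u ×ˢ 𝓝[≥] v, (x p.1, x p.2) ∉ V :=
    (((x.isCadlag u).1.tendsto.comp tendsto_fst).prodMk_nhds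
      ((x.isCadlag v).1.tendsto.comp tendsto_snd)).eventually (hV.isOpen_compl.mem_nhds hnot)
  have h2 : ∀ᶠ p in 𝓝[≥] u ×ˢ 𝓝[≥] v, dist p.1 p.2 < δ := by
    refine (Tendsto.eventually_lt_const huv ?_)
    exact ((tendsto_id.mono_left nhdsWithin_le_nhds).comp tendsto_fst).dist
      ((tendsto_id.mono_left nhdsWithin_le_nhds).comp tendsto_snd)
  obtain ⟨u', hu', h3⟩ := ((hD u).and_eventually (h1.and h2).curry).exists
  obtain ⟨v', hv', h4⟩ := ((hD v).and_eventually h3).exists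
  exact h4.1 (hx u' hu' v' hv' h4.2)

theorem measurableSet_modulusSetOn_closePairs {D : Set (Icc (0 : ℝ) T)} (hD : D.Countable)
    (G : C(UnitAddCircle, ℝ)) (c δ : ℝ) :
    MeasurableSet (modulusSetOn D (SubProb.closePairs G c) δ) := by
  have h : modulusSetOn D (SubProb.closePairs G c) δ = ⋂ u ∈ D, ⋂ v ∈ D, ⋂ (_ : dist u v < δ),
      {x : CadlagPath (Icc (0 : ℝ) T) SubProb | |(x u).integrals G - (x v).integrals G| ≤ c} := by
    ext x
    simp only [modulusSetOn, SubProb.closePairs, mem_ofPred_eq, mem_iInter]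
  rw [h]
  have hm : ∀ u : Icc (0 : ℝ) T,
      Measurable fun x : CadlagPath (Icc (0 : ℝ) T) SubProb => (x u).integrals G := fun u =>
    (SubProb.continuous_integrals G).measurable.comp (measurable_eval u)
  exact .biInter hD fun u _ => .biInter hD fun v _ => .iInter fun _ =>
    measurableSet_le ((hm u).sub (hm v)).abs measurable_const

/-- Paths which take values in `S` and are `δ`-separated, as far as times in `D` are concerned. -/
def separatedPathsOn {E : Type*} [TopologicalSpace E] (D : Set (Icc (0 : ℝ) T)) (S : Set E)
    (δ : ℝ) : Set (CadlagPath (Icc (0 : ℝ) T) E) :=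
  {x | (∀ t ∈ D, x t ∈ S) ∧ IsSeparatedOn x D δ}

/-- Equality of two values becomes measurable once the values are known to lie in the finite set
`S`: it is then a finite union of conditions on single points. -/
theorem measurableSet_separatedPathsOn {E : Type*} [TopologicalSpace E] [T1Space E]
    [MeasurableSpace E] [OpensMeasurableSpace E] {D : Set (Icc (0 : ℝ) T)} (hD : D.Countable)
    {S : Set E} (hS : S.Finite) (δ : ℝ) : MeasurableSet (separatedPathsOn D S δ) := by
  let M : Set (CadlagPath (Icc (0 : ℝ) T) E) := ⋂ t ∈ D, {x | x t ∈ S}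
  let Q : Icc (0 : ℝ) T → Icc (0 : ℝ) T → Set (CadlagPath (Icc (0 : ℝ) T) E) := fun s t =>
    ⋃ a ∈ S, {x | x s = a} ∩ {x | x t = a}
  have hM : MeasurableSet M := .biInter hD fun t _ => measurable_eval t hS.measurableSet
  have hQ : ∀ s t, MeasurableSet (Q s t) := fun s t => .biUnion hS.countable fun a _ =>
    (measurable_eval s (measurableSet_singleton a)).inter
      (measurable_eval t (measurableSet_singleton a))
  have hQM : ∀ x ∈ M, ∀ s ∈ D, ∀ t ∈ D, x ∈ Q s t ↔ x s = x t := by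
    intro x hx s hs t ht
    simp only [Q, mem_iUnion, mem_inter_iff, mem_ofPred_eq, exists_prop]
    constructor
    · rintro ⟨a, -, h1, h2⟩
      exact h1.trans h2.symm
    · exact fun h => ⟨x t, mem_iInter₂.1 hx t ht, h, rfl⟩
  have h : separatedPathsOn D S δ = M ∩
      ((⋂ s ∈ D, ⋂ t ∈ D, ⋂ u ∈ D, ⋂ (_ : s < t), ⋂ (_ : t < u), ⋂ (_ : dist s u < δ),
          Q s t ∪ Q t u) ∩
        ((⋂ s ∈ D, ⋂ t ∈ D, ⋂ (_ : (s : ℝ) < δ), ⋂ (_ : (t : ℝ) < δ), Q s t) ∩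
          ⋂ s ∈ D, ⋂ t ∈ D, ⋂ (_ : T - δ < s), ⋂ (_ : T - δ < t), ⋂ (_ : (s : ℝ) < T),
            ⋂ (_ : (t : ℝ) < T), Q s t)) := by
    ext x
    simp only [separatedPathsOn, mem_ofPred_eq, mem_inter_iff, mem_iInter, mem_union]
    constructor
    · rintro ⟨hxS, hx⟩
      have hxM : x ∈ M := mem_iInter₂.2 hxS
      refine ⟨hxM, fun s hs t ht u hu h1 h2 h3 => ?_, fun s hs t ht h1 h2 => ?_,
        fun s hs t ht h1 h2 h3 h4 => ?_⟩
      · rw [hQM x hxM s hs t ht, hQM x hxM t ht u hu]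
        exact hx.mid s hs t ht u hu h1 h2 h3
      · exact (hQM x hxM s hs t ht).2 (hx.left s hs t ht h1 h2)
      · exact (hQM x hxM s hs t ht).2 (hx.right s hs t ht h1 h2 h3 h4)
    · rintro ⟨hxM, h1, h2, h3⟩
      refine ⟨fun t ht => mem_iInter₂.1 hxM t ht, fun s hs t ht u hu e1 e2 e3 => ?_,
        fun s hs t ht e1 e2 => ?_, fun s hs t ht e1 e2 e3 e4 => ?_⟩
      · rw [← hQM x hxM s hs t ht, ← hQM x hxM t ht u hu]
        exact h1 s hs t ht u hu e1 e2 e3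
      · exact (hQM x hxM s hs t ht).1 (h2 s hs t ht e1 e2)
      · exact (hQM x hxM s hs t ht).1 (h3 s hs t ht e1 e2 e3 e4)
  rw [h]
  refine hM.inter (MeasurableSet.inter ?_ (MeasurableSet.inter ?_ ?_))
  · exact .biInter hD fun s _ => .biInter hD fun t _ => .biInter hD fun u _ => .iInter fun _ =>
      .iInter fun _ => .iInter fun _ => (hQ s t).union (hQ t u)
  · exact .biInter hD fun s _ => .biInter hD fun t _ => .iInter fun _ => .iInter fun _ => hQ s t
  · exact .biInter hD fun s _ => .biInter hD fun t _ => .iInter fun _ => .iInter fun _ =>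
      .iInter fun _ => .iInter fun _ => hQ s t

theorem separatedPathsOn_subset_stepPaths {E : Type*} [UniformSpace E] [T1Space E] (hT : 0 < T)
    {D : Set (Icc (0 : ℝ) T)} (hD : IsRightDense D) {S : Set E} (hS : S.Finite) {δ : ℝ}
    (hδ : 0 < δ) : separatedPathsOn D S δ ⊆ stepPaths T S δ (⌊T / δ⌋₊ + 1) := by
  rintro x ⟨hxS, hx⟩
  have hxS' : ∀ t, x t ∈ S := by
    intro t
    by_contra hnot
    have h1 : ∀ᶠ s in 𝓝[≥] t, x s ∉ S :=
      (x.isCadlag t).1.eventually (hS.isClosed.isOpen_compl.mem_nhds hnot)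
    obtain ⟨s, hs, hs'⟩ := ((hD t).and_eventually h1).exists
    exact hs' (hxS s hs)
  exact (hx.univ_of_isRightDense hS hxS' hD).mem_stepPaths hT hS hxS' hδ

/-- The law of a process with finitely many values gives most of its mass to separated paths. -/
theorem exists_measure_compl_separatedPathsOn_le {E : Type*} [TopologicalSpace E] [T1Space E]
    [MeasurableSpace E] [OpensMeasurableSpace E] (hT : 0 < T) {D : Set (Icc (0 : ℝ) T)}
    (hD : D.Countable) {S : Set E} (hS : S.Finite) {Ω : Type*} [MeasurableSpace Ω] {P : Measure Ω}
    [IsFiniteMeasure P] {X : Ω → CadlagPath (Icc (0 : ℝ) T) E} (hX : Measurable X)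
    (hXS : ∀ ω t, X ω t ∈ S) {ε : ℝ≥0∞} (hε : 0 < ε) :
    ∃ δ > 0, P (X ⁻¹' (separatedPathsOn D S δ)ᶜ) ≤ ε := by
  let A : ℕ → Set Ω := fun n => X ⁻¹' (separatedPathsOn D S (1 / ((n : ℝ) + 1)))ᶜ
  have hA : Antitone A := by
    intro m n hmn ω hω h
    exact hω ⟨h.1, h.2.mono (one_div_le_one_div_of_le (by positivity) (by gcongr))⟩
  have hAm : ∀ n, NullMeasurableSet (A n) P := fun n =>
    (hX (measurableSet_separatedPathsOn hD hS _).compl).nullMeasurableSet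
  -- Every path with finitely many values is separated at some scale, so these decreasing events
  -- have empty intersection.
  have hAe : ⋂ n, A n = ∅ := by
    refine eq_empty_of_forall_notMem fun ω hω => ?_
    obtain ⟨δ, hδ, h⟩ := exists_isSeparatedOn hT hS (hXS ω)
    obtain ⟨n, hn⟩ := exists_nat_one_div_lt hδ
    refine mem_iInter.1 hω n ⟨fun t _ => hXS ω t, ?_⟩
    exact ⟨fun s _ t _ u _ => (h.mono hn.le).mid s trivial t trivial u trivial,
      fun s _ t _ => (h.mono hn.le).left s trivial t trivial,
      fun s _ t _ => (h.mono hn.le).right s trivial t trivial⟩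
  have hlim := tendsto_measure_iInter_atTop hAm hA ⟨0, measure_ne_top _ _⟩
  rw [hAe, measure_empty] at hlim
  obtain ⟨n, hn⟩ := (hlim.eventually (gt_mem_nhds hε)).exists
  exact ⟨1 / ((n : ℝ) + 1), by positivity, hn.le⟩

end MeasurableSets

/-! ### Tightness -/

section Tightness

variable {k : ℕ} {b : Fin k → UnitAddCircle} {β : ℝ} {T : ℝ}

/-- The probability that the integral of a test function oscillates by more than `2κ` within
a time `δ` before `T`. -/
theorem IsExclusionLaw.measure_oscillation_le (hβ : 0 ≤ β) {N : ℕ+}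
    {μ : Measure (Config N)} [IsProbabilityMeasure μ] {P : Measure (CadlagPath ℝ≥0 (Config N))}
    (hP : IsExclusionLaw b β N μ P) {H : C(UnitAddCircle, ℝ)} {C : ℝ}
    (hH : HasDifferenceBound H C) {θ : ℝ} (hθ : 0 ≤ θ) (hθN : θ * C ≤ (N : ℕ)) {δ : ℝ}
    (hδ : 0 < δ) {κ : ℝ} :
    P {ω | ∃ u v : ℝ≥0, u ≤ v ∧ u ≤ T ∧ (v : ℝ) < u + δ ∧
      2 * κ < |(empiricalMeasure (ω u)).integrals H - (empiricalMeasure (ω v)).integrals H|} ≤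
    ((⌊T / δ⌋₊ + 1 : ℕ) : ℝ≥0∞) * (2 * ENNReal.ofReal
      (Real.exp ((θ * ((k + 1) * C) + θ ^ 2 * C ^ 2 / (N : ℕ)) * (2 * δ) - θ * κ))) := by
  set q : ℝ≥0∞ := ENNReal.ofReal
    (Real.exp ((θ * ((k + 1) * C) + θ ^ 2 * C ^ 2 / (N : ℕ)) * (2 * δ) - θ * κ)) with hq
  let d : ℝ≥0 := ⟨δ, hδ.le⟩
  have hd : 0 < d := hδ
  have hB0 : 0 ≤ θ * ((k + 1) * C) + θ ^ 2 * C ^ 2 / (N : ℕ) := by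
    have := hH.nonneg
    positivity
  -- If `u` lies in `[jδ, (j+1)δ)` and `u ≤ v < u + δ`, both lie in a window of length `2δ` starting
  -- at `jδ`. An oscillation above `2κ` forces a deviation of at least `κ` from the value at `jδ`,
  -- and a fall for `H` is a rise for `-H`.
  let U : C(UnitAddCircle, ℝ) → ℕ → Set (CadlagPath ℝ≥0 (Config N)) := fun G j =>
    {ω | ∃ t, j * d ≤ t ∧ t < j * d + 2 * d ∧
      (empiricalMeasure (ω (j * d))).integrals G + κ ≤ (empiricalMeasure (ω t)).integrals G}
  have hU : ∀ (G : C(UnitAddCircle, ℝ)) (j : ℕ), HasDifferenceBound G C → P (U G j) ≤ q := by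
    intro G j hG
    exact hP.measure_exists_le hθ hB0 (generator_exp_le hβ hG hθ hθN) (j * d)
      (r := 2 * d) (by positivity) κ
  have hsub : {ω : CadlagPath ℝ≥0 (Config N) | ∃ u v : ℝ≥0, u ≤ v ∧ u ≤ T ∧ (v : ℝ) < u + δ ∧
      2 * κ < |(empiricalMeasure (ω u)).integrals H - (empiricalMeasure (ω v)).integrals H|} ⊆
      ⋃ j ∈ Finset.range (⌊T / δ⌋₊ + 1), U H j ∪ U (-H) j := by
    rintro ω ⟨u, v, huv, huT, hvu, hκ⟩
    have hudiv : (0 : ℝ) ≤ u / δ := div_nonneg u.2 hδ.le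
    refine mem_iUnion₂.2 ⟨⌊(u : ℝ) / δ⌋₊, ?_, ?_⟩
    · exact Finset.mem_range.2 (Nat.lt_succ_of_le (Nat.floor_mono (by gcongr)))
    · set j := ⌊(u : ℝ) / δ⌋₊ with hj
      have h1 : j * d ≤ u := by
        rw [← NNReal.coe_le_coe]
        push_cast
        exact (le_div_iff₀ hδ).1 (Nat.floor_le hudiv)
      have h2 : u < j * d + d := by
        rw [← NNReal.coe_lt_coe]
        push_cast
        have h3 := (div_lt_iff₀ hδ).1 (Nat.lt_floor_add_one ((u : ℝ) / δ))
        change (u : ℝ) < j * δ + δ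
        linarith
      have h3 : u < j * d + 2 * d := h2.trans_le (by rw [two_mul]; gcongr; simp)
      have h4 : v < j * d + 2 * d := by
        have h5 : v < u + d := hvu
        refine h5.trans ?_
        rw [two_mul, ← add_assoc]
        gcongr
      by_contra hnot
      simp only [mem_union, not_or, U, mem_ofPred_eq, not_exists, not_and, not_le,
        SubProb.integrals_neg] at hnot
      have e1 := hnot.1 u h1 h3
      have e2 := hnot.2 u h1 h3
      have e3 := hnot.1 v (h1.trans huv) h4
      have e4 := hnot.2 v (h1.trans huv) h4
      refine absurd hκ (not_lt.2 (abs_le.2 ⟨?_, ?_⟩)) <;> linarith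
  calc P _ ≤ P (⋃ j ∈ Finset.range (⌊T / δ⌋₊ + 1), U H j ∪ U (-H) j) := measure_mono hsub
    _ ≤ ∑ j ∈ Finset.range (⌊T / δ⌋₊ + 1), P (U H j ∪ U (-H) j) := measure_biUnion_finset_le _ _
    _ ≤ ∑ j ∈ Finset.range (⌊T / δ⌋₊ + 1), 2 * q := by
        refine Finset.sum_le_sum fun j _ => (measure_union_le _ _).trans ?_
        rw [two_mul]
        exact add_le_add (hU H j hH) (hU (-H) j hH.neg)
    _ = _ := by rw [Finset.sum_const, Finset.card_range, nsmul_eq_mul]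

/-- The order of choices is `δ`, `θ`, `N₀`: the drift over time `2δ` is at most `κ / 2`, then `θ`
beats the number of windows, then `N` makes the quadratic term at most one. The exponent is thus at
most `1 - θκ/2`. -/
theorem exists_measure_compl_modulusSetOn_le (hβ : 0 ≤ β)
    {μ : (N : ℕ+) → Measure (Config N)} (hμ : ∀ N, IsProbabilityMeasure (μ N))
    {P : (N : ℕ+) → Measure (CadlagPath ℝ≥0 (Config N))}
    (hP : ∀ N, IsExclusionLaw b β N (μ N) (P N)) {H : C(UnitAddCircle, ℝ)} {C : ℝ}
    (hH : HasDifferenceBound H C) (D : Set (Icc (0 : ℝ) T)) {c : ℝ} (hc : 0 < c) {ε : ℝ≥0∞}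
    (hε : 0 < ε) :
    ∃ δ > 0, ∃ N₀ : ℕ+, ∀ N ≥ N₀,
      P N (empiricalPath T ⁻¹' (modulusSetOn D (SubProb.closePairs H c) δ)ᶜ) ≤ ε := by
  have hC := hH.nonneg
  set κ := c / 2 with hκ
  have hκ0 : 0 < κ := half_pos hc
  set K : ℝ := (k + 1) * C with hK
  have hK0 : 0 ≤ K := by positivity
  set δ := κ / (4 * (K + 1)) with hδ
  have hδ0 : 0 < δ := by positivity
  have hδK : K * (2 * δ) ≤ κ / 2 := by
    have h1 : δ * (4 * (K + 1)) = κ := div_mul_cancel₀ _ (by positivity)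
    nlinarith
  have hlim : Tendsto (fun θ : ℝ => ((⌊T / δ⌋₊ + 1 : ℕ) : ℝ≥0∞) * (2 * ENNReal.ofReal
      (Real.exp (1 - θ * (κ / 2))))) atTop (𝓝 0) := by
    have h1 : Tendsto (fun θ : ℝ => Real.exp (1 - θ * (κ / 2))) atTop (𝓝 0) := by
      refine Real.tendsto_exp_atBot.comp ?_
      exact (tendsto_const_nhds (x := (1 : ℝ))).add_atBot
        (tendsto_neg_atTop_atBot.comp (tendsto_id.atTop_mul_const (half_pos hκ0))) |>.congr
          fun θ => by simp [sub_eq_add_neg]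
    have h2 := ENNReal.tendsto_ofReal h1
    rw [ENNReal.ofReal_zero] at h2
    have h3 := ENNReal.Tendsto.const_mul (a := ((⌊T / δ⌋₊ + 1 : ℕ) : ℝ≥0∞))
      (ENNReal.Tendsto.const_mul (a := 2) h2 (Or.inr (by simp)))
      (Or.inr (ENNReal.natCast_ne_top _))
    simpa using h3
  obtain ⟨θ, hθε, hθ⟩ := ((hlim.eventually (gt_mem_nhds hε)).and (eventually_ge_atTop 0)).exists
  -- The first entry is the condition of `generator_exp_le`, the second makes the quadratic term at
  -- most one.
  obtain ⟨n, hn⟩ := exists_nat_ge (max (θ * C) (θ ^ 2 * C ^ 2 * (2 * δ)))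
  refine ⟨δ, hδ0, n.succPNat, fun N hN => ?_⟩
  have := hμ N
  have hnN : (n : ℝ) ≤ (N : ℕ) := by
    have h1 : n + 1 ≤ (N : ℕ) := by exact_mod_cast hN
    exact_mod_cast (Nat.le_succ n).trans h1
  have hN0 : (0 : ℝ) < (N : ℕ) := Nat.cast_pos.2 N.pos
  have hosc := (hP N).measure_oscillation_le (T := T) hβ hH hθ
    ((le_max_left _ _).trans (hn.trans hnN)) hδ0 (κ := κ)
  refine le_trans (measure_mono ?_) (hosc.trans (le_trans ?_ hθε.le))
  · intro ω hω
    simp only [mem_preimage, mem_compl_iff, modulusSetOn, mem_ofPred_eq, not_forall,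
      SubProb.closePairs, not_le] at hω
    obtain ⟨u, -, v, -, huv, hgt⟩ := hω
    have h2κ : 2 * κ = c := by rw [hκ]; ring
    rw [Subtype.dist_eq, Real.dist_eq] at huv
    have huv' := abs_lt.1 huv
    rcases le_total u v with h | h
    · refine ⟨⟨u, u.2.1⟩, ⟨v, v.2.1⟩, h, u.2.2, ?_, ?_⟩
      · change (v : ℝ) < u + δ
        linarith
      · rw [h2κ]
        exact hgt
    · refine ⟨⟨v, v.2.1⟩, ⟨u, u.2.1⟩, h, v.2.2, ?_, ?_⟩
      · change (u : ℝ) < v + δ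
        linarith
      · rw [h2κ, abs_sub_comm]
        exact hgt
  · refine mul_le_mul_right (mul_le_mul_right (ENNReal.ofReal_le_ofReal (Real.exp_le_exp.2 ?_)) _) _
    have h1 : θ ^ 2 * C ^ 2 / (N : ℕ) * (2 * δ) ≤ 1 := by
      rw [div_mul_eq_mul_div, div_le_one hN0]
      exact (le_max_right _ _).trans (hn.trans hnN)
    have h2 : θ * (K * (2 * δ)) ≤ θ * (κ / 2) := mul_le_mul_of_nonneg_left hδK hθ
    rw [add_mul, mul_assoc θ]
    linarith

/-- Half of `ε` pays for leaving `K N`; the other half is split into summable weights `w p` over the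
countably many moduli. -/
theorem isTightMeasureSet_range_empiricalLaw (hβ : 0 ≤ β) (hT : 0 < T)
    {μ : (N : ℕ+) → Measure (Config N)} (hμ : ∀ N, IsProbabilityMeasure (μ N))
    {P : (N : ℕ+) → Measure (CadlagPath ℝ≥0 (Config N))}
    (hP : ∀ N, IsExclusionLaw b β N (μ N) (P N)) :
    IsTightMeasureSet (range fun N : ℕ+ => empiricalLaw T (P N)) := by
  refine isTightMeasureSet_iff_exists_isCompact_measure_compl_le.2 fun ε hε => ?_
  have hε2 : 0 < ε / 2 := ENNReal.half_pos hε.ne'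
  obtain ⟨s, hsc, hsd, hs⟩ := exists_countable_dense_hasDifferenceBound
  obtain ⟨D, hDc, hD⟩ := exists_countable_isRightDense T
  have := hsc.to_subtype
  obtain ⟨w, hw0, hw⟩ := ENNReal.exists_pos_sum_of_countable' hε2.ne' (s × ℕ)
  let V : s × ℕ → Set (SubProb × SubProb) := fun p => SubProb.closePairs p.1 (1 / (p.2 + 1))
  have hmod : ∀ p : s × ℕ, ∃ δ > 0, ∃ N₀ : ℕ+, ∀ N ≥ N₀,
      P N (empiricalPath T ⁻¹' (modulusSetOn D (V p) δ)ᶜ) ≤ w p := fun p => by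
    obtain ⟨C, hC⟩ := hs p.1 p.1.2
    exact exists_measure_compl_modulusSetOn_le hβ hμ hP hC D (by positivity) (hw0 p)
  choose δ hδ N₀ hN₀ using hmod
  let S : ℕ+ → Set SubProb := fun N => range (empiricalMeasure (N := N))
  have hS : ∀ N, (S N).Finite := fun N => finite_range _
  have hsep : ∀ N : ℕ+, ∃ r > 0,
      P N (empiricalPath T ⁻¹' (separatedPathsOn D (S N) r)ᶜ) ≤ ε / 2 := fun N => by
    have := hμ N
    have := (hP N).isProbabilityMeasure
    exact exists_measure_compl_separatedPathsOn_le hT hDc (hS N) (measurable_empiricalPath T)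
      (fun ω t => mem_range_self _) hε2
  choose r hr hrP using hsep
  let K : ℕ+ → Set (CadlagPath (Icc (0 : ℝ) T) SubProb) := fun N =>
    stepPaths T (S N) (r N) (⌊T / r N⌋₊ + 1)
  refine ⟨_, isCompact_modulusSet_union (T := T) hδ
    (fun p : s × ℕ => SubProb.isClosed_closePairs _ _)
    (SubProb.iInf_closePairs_le_uniformity hsd) N₀ (K := K)
    fun N => isCompact_stepPaths hT.le (hS N) (hr N) _, ?_⟩
  rintro _ ⟨N, rfl⟩
  let A : Set (CadlagPath (Icc (0 : ℝ) T) SubProb) := (separatedPathsOn D (S N) (r N))ᶜ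
  -- Only the moduli with `N₀ p ≤ N` are charged. `A` and the `M p` form a measurable cover of the
  -- complement of the compact set, on which the image measure can be evaluated.
  let M : s × ℕ → Set (CadlagPath (Icc (0 : ℝ) T) SubProb) := fun p =>
    ⋃ (_ : N₀ p ≤ N), (modulusSetOn D (V p) (δ p))ᶜ
  have hA : MeasurableSet A := (measurableSet_separatedPathsOn hDc (hS N) _).compl
  have hM : ∀ p, MeasurableSet (M p) := fun p =>
    .iUnion fun _ => (measurableSet_modulusSetOn_closePairs hDc _ _ _).compl
  have hsub : ({x | ∀ p, x ∈ modulusSet T (V p) (δ p)} ∪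
      ⋃ n, K n ∩ {x | ∀ p, N₀ p ≤ n → x ∈ modulusSet T (V p) (δ p)})ᶜ ⊆ A ∪ ⋃ p, M p := by
    intro x hx
    by_contra hnot
    simp only [mem_union, mem_iUnion, not_or, not_exists, A, M, mem_compl_iff, not_not] at hnot
    refine hx (Or.inr (mem_iUnion.2 ⟨N, separatedPathsOn_subset_stepPaths hT hD (hS N) (hr N)
      hnot.1, fun p hp => ?_⟩))
    exact modulusSetOn_subset hD (SubProb.isClosed_closePairs _ _) _ (hnot.2 p hp)
  have hmap : ∀ B, MeasurableSet B → empiricalLaw T (P N) B = P N (empiricalPath T ⁻¹' B) :=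
    fun B hB => Measure.map_apply (measurable_empiricalPath T) hB
  calc empiricalLaw T (P N) _ ≤ empiricalLaw T (P N) (A ∪ ⋃ p, M p) := measure_mono hsub
    _ ≤ empiricalLaw T (P N) A + ∑' p, empiricalLaw T (P N) (M p) :=
        (measure_union_le _ _).trans (add_le_add le_rfl (measure_iUnion_le _))
    _ ≤ ε / 2 + ∑' p, w p := by
        refine add_le_add ?_ (ENNReal.tsum_le_tsum fun p => ?_)
        · rw [hmap A hA]
          exact hrP N
        · rw [hmap _ (hM p)]
          by_cases hp : N₀ p ≤ N
          · simp only [M, hp, iUnion_true]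
            exact hN₀ p N hp
          · simp [M, hp]
    _ ≤ ε := (add_le_add le_rfl hw.le).trans (ENNReal.add_halves ε).le

end Tightness

end SlowBonds

end

theorem mainTheorem4 {k : ℕ} (b : Fin k → UnitAddCircle) (β : ℝ) (hβ : 0 ≤ β)
    (T : ℝ) (hT : 0 < T)
    (μ : (N : ℕ+) → Measure (Config N)) (hμ : ∀ N, IsProbabilityMeasure (μ N))
    (P : (N : ℕ+) → Measure (CadlagPath ℝ≥0 (Config N)))
    (hP : ∀ N, IsExclusionLaw b β N (μ N) (P N)) :
    IsTightMeasureSet (Set.range fun N : ℕ+ => empiricalLaw T (P N)) := by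
  exact isTightMeasureSet_range_empiricalLaw hβ hT hμ hP
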